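/- Let $n\ge 3$ and let $$D=\{z\in\mathbb C^n : |z|<1,\ 2|z|^2<1+|z^\top z|^2\}$$ be the $n$-dimensional Cartan domain of type IV. For real $\lambda>n-1$ let $v_\lambda$ be the probability measure on $D$ with density proportional to $(1-2|z|^2+|z^\top z|^2)^{\lambda-n}$ with respect to Lebesgue measure. Let $\mathcal A^2_\lambda(D)$ be the closed subspace of $L^2(D,v_\lambda)$ consisting of the (classes of) holomorphic functions, and let $B_\lambda$ be the orthogonal projection of $L^2(D,v_\lambda)$ onto it. For $a\in L^\infty(D)$ let $T_a^{(\lambda)}f=B_\lambda(af)$ be the Toeplitz operator with symbol $a$ on $\mathcal A^2_\lambda(D)$. Identify $\mathrm{SO}(2)$ with the unit circle in $\mathbb C$ and let $\mathrm{SO}(n)\times\mathrm{SO}(2)$ act on $D$ by $(A,t)\cdot z=tAz$. For a subgroup $H\subseteq\mathrm{SO}(n)\times\mathrm{SO}(2)$ let $L^\infty(D)^H$ be the set of all $a\in L^\infty(D)$ such that $a\circ h^{-1}=a$ almost everywhere for every $h\in H$, and let $\mathcal T^{(\lambda)}(L^\infty(D)^H)$ be the unital Banach algebra generated by the operators $T_a^{(\lambda)}$,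 $a\in L^\infty(D)^H$, that is, the closure in operator norm of the unital algebra generated by them. Then, for every $n\ge3$ and every $\lambda>n-1$: 1. $\mathcal T^{(\lambda)}(L^\infty(D)^{\mathrm{SO}(n)\times\mathrm{SO}(2)})$ is a commutative $C^*$-algebra. 2. If $H$ is any one of the three subgroups $\mathrm{SO}(n-1)\times\mathrm{SO}(2)$, $\mathrm T_n\times\mathrm{SO}(2)$, $\{I_n\}\times\mathrm{SO}(2)$, then $\mathcal T^{(\lambda)}(L^\infty(D)^H)$ is a $C^*$-algebra that is not commutative. Here $\mathrm{SO}(n-1)$ is embedded in $\mathrm{SO}(n)$ as the upper left corner, and $\mathrm T_n\subset\mathrm{SO}(n)$ is the maximal torus of block diagonal matrices $\mathrm{diag}(R(\theta_1),\dots,R(\theta_{\lfloor n/2\rfloor}))$, $\theta_j\in\mathbb R$, with a trailing diagonal entry $1$ when $n$ is odd, where $R(\vartheta)=\begin{pmatrix}\cos\vartheta&\sin\vartheta\\-\sin\vartheta&\cos\vartheta\end{pmatrix}$. -/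

import Mathlib

open MeasureTheory Matrix
open scoped ENNReal

noncomputable section

namespace CartanIV

/-! ### The group `SO(n) × SO(2)` and its subgroups -/

/-- `SO(m)`. -/
abbrev SO (m : ℕ) : Type := Matrix.specialOrthogonalGroup (Fin m) ℝ

/-- `SO(n) × SO(2)`, with `SO(2)` identified with the unit circle of `ℂ`. -/
abbrev K (n : ℕ) : Type := SO n × Circle

/-- The matrix with upper left block `B`, lower right entry `1` and zeros elsewhere. -/
def cornerMatrix {m : ℕ} (B : Matrix (Fin m) (Fin m) ℝ) : Matrix (Fin (m + 1)) (Fin (m + 1)) ℝ :=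
  Matrix.reindex finSumFinEquiv finSumFinEquiv
    (Matrix.fromBlocks B 0 0 (1 : Matrix (Fin 1) (Fin 1) ℝ))

theorem mem_SO_iff {ι : Type*} [Fintype ι] [DecidableEq ι] {A : Matrix ι ι ℝ} :
    A ∈ Matrix.specialOrthogonalGroup ι ℝ ↔ A * Aᵀ = 1 ∧ A.det = 1 := by
  rw [Matrix.mem_specialOrthogonalGroup_iff, Matrix.mem_orthogonalGroup_iff]

theorem reindex_mul {ι κ : Type*} [Fintype ι] [Fintype κ] (e : ι ≃ κ) (A B : Matrix ι ι ℝ) :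
    Matrix.reindex e e (A * B) = Matrix.reindex e e A * Matrix.reindex e e B :=
  (Matrix.submatrix_mul_equiv A B e.symm e.symm e.symm).symm

theorem reindex_mem_SO {ι κ : Type*} [Fintype ι] [DecidableEq ι] [Fintype κ] [DecidableEq κ]
    (e : ι ≃ κ) {A : Matrix ι ι ℝ} (hA : A ∈ Matrix.specialOrthogonalGroup ι ℝ) :
    Matrix.reindex e e A ∈ Matrix.specialOrthogonalGroup κ ℝ := by
  rw [mem_SO_iff] at hA ⊢
  refine ⟨?_, by simpa using hA.2⟩
  rw [Matrix.transpose_reindex, ← reindex_mul, hA.1]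
  simp

theorem fromBlocks_mem_SO {ι κ : Type*} [Fintype ι] [DecidableEq ι] [Fintype κ] [DecidableEq κ]
    {A : Matrix ι ι ℝ} (hA : A ∈ Matrix.specialOrthogonalGroup ι ℝ) :
    Matrix.fromBlocks A 0 0 (1 : Matrix κ κ ℝ) ∈ Matrix.specialOrthogonalGroup (ι ⊕ κ) ℝ := by
  rw [mem_SO_iff] at hA ⊢
  refine ⟨?_, by simpa using hA.2⟩
  simp [Matrix.fromBlocks_transpose, Matrix.fromBlocks_multiply, hA.1]

theorem reindex_fromBlocks_mul {ι κ μ : Type*} [Fintype ι] [DecidableEq ι] [Fintype κ]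
    [DecidableEq κ] [Fintype μ] [DecidableEq μ] (e : ι ⊕ κ ≃ μ) (A B : Matrix ι ι ℝ) :
    Matrix.reindex e e (Matrix.fromBlocks (A * B) 0 0 (1 : Matrix κ κ ℝ)) =
      Matrix.reindex e e (Matrix.fromBlocks A 0 0 1) *
        Matrix.reindex e e (Matrix.fromBlocks B 0 0 1) := by
  rw [← reindex_mul]
  simp [Matrix.fromBlocks_multiply]

/-- The upper left corner embedding `SO(m) → SO(m + 1)`. -/
def cornerHom (m : ℕ) : SO m →* SO (m + 1) where
  toFun B := ⟨cornerMatrix B.1, reindex_mem_SO _ (fromBlocks_mem_SO B.2)⟩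
  map_one' := by
    apply Subtype.ext
    simp [cornerMatrix, Matrix.fromBlocks_one]
  map_mul' A B := Subtype.ext (reindex_fromBlocks_mul _ A.1 B.1)

/-- The rotation matrix `R(θ)`. -/
def rot (θ : ℝ) : Matrix (Fin 2) (Fin 2) ℝ :=
  !![Real.cos θ, Real.sin θ; -Real.sin θ, Real.cos θ]

theorem rot_mem (θ : ℝ) : rot θ * (rot θ)ᵀ = 1 ∧ (rot θ).det = 1 := by
  have h := Real.sin_sq_add_cos_sq θ
  constructor
  · ext i j
    fin_cases i <;> fin_cases j <;> simp [rot, Matrix.mul_apply, Fin.sum_univ_two] <;> linarith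
  · simp [rot, Matrix.det_fin_two]; linarith

theorem rot_add (θ φ : ℝ) : rot (θ + φ) = rot θ * rot φ := by
  ext i j
  fin_cases i <;> fin_cases j <;>
    simp [rot, Matrix.mul_apply, Fin.sum_univ_two, Real.cos_add, Real.sin_add] <;> ring

theorem rot_zero : rot 0 = 1 := by
  ext i j
  fin_cases i <;> fin_cases j <;> simp [rot]

/-- The indices of `Fin n` in consecutive pairs: `(a, j)` is the index `2 * j + a`, and for odd `n`
the last index stands alone. -/
def torusIndex (n : ℕ) : (Fin 2 × Fin (n / 2)) ⊕ Fin (n % 2) ≃ Fin n :=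
  ((((Equiv.prodComm _ _).trans finProdFinEquiv).sumCongr (Equiv.refl _)).trans
    finSumFinEquiv).trans (finCongr (Nat.div_add_mod' n 2))

/-- `diag(R(θ₁), R(θ₂), …)`, with a trailing `1` when `n` is odd. -/
def torusMatrix (n : ℕ) (θ : Fin (n / 2) → ℝ) : Matrix (Fin n) (Fin n) ℝ :=
  Matrix.reindex (torusIndex n) (torusIndex n)
    (Matrix.fromBlocks (Matrix.blockDiagonal fun j => rot (θ j)) 0 0 1)

theorem torusMatrix_mem (n : ℕ) (θ : Fin (n / 2) → ℝ) :
    torusMatrix n θ ∈ Matrix.specialOrthogonalGroup (Fin n) ℝ := by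
  refine reindex_mem_SO _ (fromBlocks_mem_SO (mem_SO_iff.2 ⟨?_, ?_⟩))
  · rw [Matrix.blockDiagonal_transpose, ← Matrix.blockDiagonal_mul]
    simp only [(rot_mem _).1]
    exact Matrix.blockDiagonal_one
  · simp [Matrix.det_blockDiagonal, (rot_mem _).2]

/-- The parametrization of the maximal torus `T_n` of `SO(n)`; its range is `T_n`. -/
def torusHom (n : ℕ) : Multiplicative (Fin (n / 2) → ℝ) →* SO n where
  toFun θ := ⟨torusMatrix n θ.toAdd, torusMatrix_mem n _⟩
  map_one' := by
    apply Subtype.ext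
    have : (Matrix.blockDiagonal fun _ : Fin (n / 2) => (1 : Matrix (Fin 2) (Fin 2) ℝ)) = 1 :=
      Matrix.blockDiagonal_one
    simp [torusMatrix, rot_zero, this, Matrix.fromBlocks_one]
  map_mul' θ φ := by
    apply Subtype.ext
    refine Eq.trans ?_ (reindex_fromBlocks_mul _ _ _)
    rw [← Matrix.blockDiagonal_mul]
    simp [torusMatrix, rot_add]

/-- `SO(n) × SO(2)`. -/
def subgroupSOn (n : ℕ) : Subgroup (K n) := ⊤

/-- `SO(n - 1) × SO(2)`, for `n ≥ 1`. -/
def subgroupCorner : (n : ℕ) → Subgroup (K n)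
  | 0 => ⊤
  | m + 1 => (cornerHom m).range.prod ⊤

/-- `T_n × SO(2)`. -/
def subgroupTorus (n : ℕ) : Subgroup (K n) := (torusHom n).range.prod ⊤

/-- `SO(2)`, that is `{1} × SO(2)`. -/
def subgroupCircle (n : ℕ) : Subgroup (K n) := (⊥ : Subgroup (SO n)).prod ⊤

/-- The action `(A, t) · z = t A z`. -/
def act {n : ℕ} (g : K n) (z : Fin n → ℂ) : Fin n → ℂ :=
  (g.2 : ℂ) • (g.1.1.map ((↑) : ℝ → ℂ) *ᵥ z)

/-! ### Holomorphic functions in `L²`: closedness -/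

theorem enorm_le_lintegral_circle {E : Type*} [NormedAddCommGroup E] [NormedSpace ℂ E]
    {U : Set E} (hU : IsOpen U) {f : E → ℂ} (hf : DifferentiableOn ℂ f U) {z w : E}
    (hw : ∀ c : ℂ, ‖c‖ ≤ 1 → z + c • w ∈ U) :
    ENNReal.ofReal (2 * Real.pi) * ‖f z‖ₑ ≤
      ∫⁻ θ in Set.Ioc 0 (2 * Real.pi), ‖f (z + Complex.exp (θ * Complex.I) • w)‖ₑ := by
  have h1 : DiffContOnCl ℂ (fun c : ℂ => f (z + c • w)) (Metric.ball 0 |1|) := by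
    apply DifferentiableOn.diffContOnCl
    rw [abs_one, closure_ball (0 : ℂ) one_ne_zero]
    intro c hc
    have hc' : z + c • w ∈ U := hw c (by simpa using hc)
    have h2 : DifferentiableAt ℂ f (z + c • w) := (hf _ hc').differentiableAt (hU.mem_nhds hc')
    have h3 : DifferentiableAt ℂ (fun c : ℂ => z + c • w) c := by fun_prop
    exact (h2.comp c h3).differentiableWithinAt
  have h2 := h1.circleAverage
  simp only [Real.circleAverage, zero_smul, add_zero] at h2
  rw [← h2, intervalIntegral.integral_of_le Real.two_pi_pos.le, enorm_smul]
  have h3 : ‖((2 * Real.pi)⁻¹ : ℝ)‖ₑ = (ENNReal.ofReal (2 * Real.pi))⁻¹ := by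
    rw [Real.enorm_of_nonneg (inv_nonneg.2 Real.two_pi_pos.le),
      ENNReal.ofReal_inv_of_pos Real.two_pi_pos]
  rw [h3, ← mul_assoc, ENNReal.mul_inv_cancel (by simp [Real.pi_pos]) ENNReal.ofReal_ne_top,
    one_mul]
  refine (enorm_integral_le_lintegral_enorm _).trans (le_of_eq ?_)
  simp [circleMap]

theorem measurePreserving_rot (n : ℕ) (θ : ℝ) :
    MeasurePreserving (fun w : Fin n → ℂ => Complex.exp (θ * Complex.I) • w) := by
  have h : MeasurePreserving (fun w : ℂ => Complex.exp (θ * Complex.I) * w) := by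
    have := (rotation (Circle.exp θ)).measurePreserving
    convert! this using 2
  exact volume_preserving_pi (fun _ : Fin n => h)

/-- Mean value inequality on a polydisc. -/
theorem volume_ball_mul_enorm_le {n : ℕ} {U : Set (Fin n → ℂ)} (hU : IsOpen U)
    {f : (Fin n → ℂ) → ℂ} (hf : DifferentiableOn ℂ f U) {z : Fin n → ℂ} {r : ℝ}
    (hz : Metric.closedBall z r ⊆ U) :
    volume (Metric.closedBall z r) * ‖f z‖ₑ ≤ ∫⁻ w in Metric.closedBall z r, ‖f w‖ₑ := by
  set B : Set (Fin n → ℂ) := Metric.closedBall 0 r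
  have hB : MeasurableSet B := Metric.isClosed_closedBall.measurableSet
  have hmem : ∀ w ∈ B, ∀ c : ℂ, ‖c‖ ≤ 1 → z + c • w ∈ U := by
    intro w hw c hc
    apply hz
    simp only [B, mem_closedBall_zero_iff] at hw
    rw [Metric.mem_closedBall, dist_eq_norm, add_sub_cancel_left, norm_smul]
    nlinarith [norm_nonneg w, norm_nonneg c]
  have hshift : ∀ g : (Fin n → ℂ) → ℝ≥0∞,
      ∫⁻ w in Metric.closedBall z r, g w = ∫⁻ w in B, g (z + w) := by
    intro g
    have := (measurePreserving_add_left (volume : Measure (Fin n → ℂ)) z).setLIntegral_comp_preimage_emb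
      (MeasurableEquiv.addLeft z).measurableEmbedding g (Metric.closedBall z r)
    rw [← this]
    congr 2
    ext w
    simp [B, dist_eq_norm]
  have hrot : ∀ θ : ℝ, ∫⁻ w in B, ‖f (z + Complex.exp (θ * Complex.I) • w)‖ₑ =
      ∫⁻ w in B, ‖f (z + w)‖ₑ := by
    intro θ
    have := (measurePreserving_rot n θ).setLIntegral_comp_preimage_emb
      ((Homeomorph.smulOfNeZero (Complex.exp (θ * Complex.I)) (Complex.exp_ne_zero _)).measurableEmbedding)
      (fun w => ‖f (z + w)‖ₑ) B
    rw [← this]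
    congr 2
    ext w
    simp [B, norm_smul, Complex.norm_exp_ofReal_mul_I]
  have hvol : volume (Metric.closedBall z r) = volume B := by
    have := hshift (fun _ => 1)
    simpa using this
  rw [hshift, hvol]
  have hpi : ENNReal.ofReal (2 * Real.pi) ≠ 0 := by simp [Real.pi_pos]
  have key : ENNReal.ofReal (2 * Real.pi) * (volume B * ‖f z‖ₑ) ≤
      ENNReal.ofReal (2 * Real.pi) * ∫⁻ w in B, ‖f (z + w)‖ₑ := by
    calc ENNReal.ofReal (2 * Real.pi) * (volume B * ‖f z‖ₑ)
        = ∫⁻ w in B, ENNReal.ofReal (2 * Real.pi) * ‖f z‖ₑ := by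
          rw [setLIntegral_const]; ring
      _ ≤ ∫⁻ w in B, ∫⁻ θ in Set.Ioc 0 (2 * Real.pi),
            ‖f (z + Complex.exp (θ * Complex.I) • w)‖ₑ :=
          setLIntegral_mono' hB fun w hw => enorm_le_lintegral_circle hU hf (hmem w hw)
      _ = ∫⁻ θ in Set.Ioc 0 (2 * Real.pi), ∫⁻ w in B,
            ‖f (z + Complex.exp (θ * Complex.I) • w)‖ₑ := by
          apply lintegral_lintegral_swap
          rw [Measure.prod_restrict]
          apply AEMeasurable.enorm
          refine ContinuousOn.aemeasurable ?_ (hB.prod measurableSet_Ioc)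
          refine hf.continuousOn.comp (t := U) (by fun_prop) ?_
          rintro ⟨w, θ⟩ hw
          exact hmem w hw.1 _ (by simp [Complex.norm_exp_ofReal_mul_I])
      _ = ENNReal.ofReal (2 * Real.pi) * ∫⁻ w in B, ‖f (z + w)‖ₑ := by
          simp only [hrot]
          rw [setLIntegral_const, Real.volume_Ioc, sub_zero, mul_comm]
  exact (ENNReal.mul_le_mul_iff_right hpi ENNReal.ofReal_ne_top).1 key

theorem norm_le_of_aeEq {n : ℕ} {U : Set (Fin n → ℂ)} (hU : IsOpen U)
    {v : Measure (Fin n → ℂ)} {z₀ : Fin n → ℂ} {R : ℝ} (hR : 0 < R) {ε : ℝ≥0∞} (hε : ε ≠ 0)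
    (hε' : ε ≠ ∞) (hsub : Metric.closedBall z₀ R ⊆ U)
    (hv : ε • volume.restrict (Metric.closedBall z₀ R) ≤ v) :
    ∃ C : ℝ, 0 ≤ C ∧ ∀ (h : (Fin n → ℂ) → ℂ) (F : Lp ℂ 2 v), DifferentiableOn ℂ h U →
      F =ᵐ[v] h → ∀ z ∈ Metric.closedBall z₀ (R / 2), ‖h z‖ ≤ C * ‖F‖ := by
  set c : ℝ≥0∞ := ε * volume (Metric.closedBall (0 : Fin n → ℂ) (R / 2)) with hc
  have hc0 : c ≠ 0 := mul_ne_zero hε (Metric.measure_closedBall_pos _ _ (half_pos hR)).ne'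
  have hct : c ≠ ∞ := ENNReal.mul_ne_top hε' measure_closedBall_lt_top.ne
  refine ⟨Real.sqrt (c.toReal⁻¹), Real.sqrt_nonneg _, ?_⟩
  intro h F hh hF z hz
  have hsub' : Metric.closedBall z (R / 2) ⊆ Metric.closedBall z₀ R := by
    apply Metric.closedBall_subset_closedBall'
    have := Metric.mem_closedBall.1 hz
    linarith
  have hF2 : ‖F‖ₑ ^ 2 = ∫⁻ w, ‖h w‖ₑ ^ 2 ∂v := by
    have := eLpNorm_nnreal_pow_eq_lintegral (f := F) (μ := v) (p := 2) two_ne_zero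
    rw [Lp.enorm_def]
    have h2 : ∫⁻ w, ‖F w‖ₑ ^ 2 ∂v = ∫⁻ w, ‖h w‖ₑ ^ 2 ∂v :=
      lintegral_congr_ae (by filter_upwards [hF] with w hw; rw [hw])
    rw [← h2]
    simpa using this
  have h1 : c * ‖h z‖ₑ ^ 2 ≤ ‖F‖ₑ ^ 2 := by
    calc c * ‖h z‖ₑ ^ 2
        = ε * (volume (Metric.closedBall z (R / 2)) * ‖h z ^ 2‖ₑ) := by
          rw [hc, Measure.addHaar_closedBall_center volume z, enorm_pow, mul_assoc]
      _ ≤ ε * ∫⁻ w in Metric.closedBall z (R / 2), ‖h w ^ 2‖ₑ := by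
          gcongr
          exact volume_ball_mul_enorm_le hU (hh.pow 2) (hsub'.trans hsub)
      _ ≤ ε * ∫⁻ w in Metric.closedBall z₀ R, ‖h w ^ 2‖ₑ := by
          gcongr
      _ = ∫⁻ w, ‖h w ^ 2‖ₑ ∂(ε • volume.restrict (Metric.closedBall z₀ R)) := by
          rw [lintegral_smul_measure, smul_eq_mul]
      _ ≤ ∫⁻ w, ‖h w ^ 2‖ₑ ∂v := lintegral_mono' hv le_rfl
      _ = ‖F‖ₑ ^ 2 := by
          rw [hF2]
          simp only [enorm_pow]
  have h2 : c.toReal * ‖h z‖ ^ 2 ≤ ‖F‖ ^ 2 := by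
    have := ENNReal.toReal_mono (by finiteness) h1
    simpa using this
  have hcp : 0 < c.toReal := ENNReal.toReal_pos hc0 hct
  apply le_of_sq_le_sq _ (by positivity)
  rw [mul_pow, Real.sq_sqrt (by positivity), inv_mul_eq_div, le_div_iff₀ hcp]
  linarith

theorem fderiv_norm_le {E : Type*} [NormedAddCommGroup E] [NormedSpace ℂ E] {f : E → ℂ} {z : E}
    {r M : ℝ} (hr : 0 < r) (hf : DifferentiableOn ℂ f (Metric.ball z r))
    (hM : ∀ w ∈ Metric.ball z r, ‖f w‖ ≤ M) : ‖fderiv ℂ f z‖ ≤ 2 * M / r := by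
  have hM0 : 0 ≤ M := (norm_nonneg _).trans (hM z (Metric.mem_ball_self hr))
  have key : ∀ δ : ℝ, 0 < δ → ‖fderiv ℂ f z‖ ≤ (2 * M + δ) / r := by
    intro δ hδ
    refine Complex.norm_fderiv_le_div_of_mapsTo_ball hf ?_ hr
    intro w hw
    rw [Metric.mem_closedBall, dist_eq_norm]
    have h1 := hM w hw
    have h2 := hM z (Metric.mem_ball_self hr)
    have h3 := norm_sub_le (f w) (f z)
    linarith
  apply le_of_forall_pos_le_add
  intro δ hδ
  have := key (δ * r) (by positivity)
  rw [add_div, mul_div_cancel_right₀ _ hr.ne'] at this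
  exact this

/-- The elements of `L²(v)` represented by a function holomorphic on `U`. -/
def holoL2 {n : ℕ} (U : Set (Fin n → ℂ)) (v : Measure (Fin n → ℂ)) : Submodule ℂ (Lp ℂ 2 v) where
  carrier := {F | ∃ h : (Fin n → ℂ) → ℂ, DifferentiableOn ℂ h U ∧ F =ᵐ[v] h}
  zero_mem' := ⟨fun _ => 0, differentiableOn_const _, Lp.coeFn_zero _ _ _⟩
  add_mem' := by
    rintro F G ⟨h, hh, hF⟩ ⟨k, hk, hG⟩
    exact ⟨h + k, hh.add hk, (Lp.coeFn_add F G).trans (hF.add hG)⟩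
  smul_mem' := by
    rintro c F ⟨h, hh, hF⟩
    exact ⟨c • h, hh.const_smul c, (Lp.coeFn_smul c F).trans (hF.const_smul c)⟩

theorem isClosed_holoL2 {n : ℕ} {U : Set (Fin n → ℂ)} (hU : IsOpen U)
    {v : Measure (Fin n → ℂ)} (hvU : v Uᶜ = 0)
    (hv : ∀ z₀ ∈ U, ∃ R : ℝ, 0 < R ∧ ∃ ε : ℝ≥0∞, ε ≠ 0 ∧ ε ≠ ∞ ∧ Metric.closedBall z₀ R ⊆ U ∧
      ε • volume.restrict (Metric.closedBall z₀ R) ≤ v) :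
    IsClosed (holoL2 U v : Set (Lp ℂ 2 v)) := by
  apply IsSeqClosed.isClosed
  intro F G hF hFG
  choose h hh hFh using hF
  have hest : ∀ z₀ ∈ U, ∃ R : ℝ, 0 < R ∧ Metric.closedBall z₀ R ⊆ U ∧ ∃ C : ℝ, 0 ≤ C ∧
      ∀ k l, ∀ z ∈ Metric.closedBall z₀ R, ‖h k z - h l z‖ ≤ C * ‖F k - F l‖ := by
    intro z₀ hz₀
    obtain ⟨R, hR, ε, hε, hε', hsub, hle⟩ := hv z₀ hz₀
    obtain ⟨C, hC, hCb⟩ := norm_le_of_aeEq hU hR hε hε' hsub hle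
    refine ⟨R / 2, half_pos hR,
      (Metric.closedBall_subset_closedBall (by linarith)).trans hsub, C, hC, ?_⟩
    intro k l z hz
    exact hCb (h k - h l) (F k - F l) ((hh k).sub (hh l))
      ((Lp.coeFn_sub _ _).trans ((hFh k).sub (hFh l))) z hz
  have hcau := hFG.cauchySeq
  -- pointwise limits of the representatives
  have hlim : ∀ z, ∃ y, z ∈ U → Filter.Tendsto (fun k => h k z) Filter.atTop (nhds y) := by
    intro z
    by_cases hz : z ∈ U
    · obtain ⟨R, hR, -, C, hC, hb⟩ := hest z hz
      have : CauchySeq fun k => h k z := by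
        rw [Metric.cauchySeq_iff] at hcau ⊢
        intro δ hδ
        obtain ⟨N, hN⟩ := hcau (δ / (C + 1)) (by positivity)
        refine ⟨N, fun k hk l hl => ?_⟩
        have h1 := hN k hk l hl
        rw [dist_eq_norm, lt_div_iff₀ (by positivity)] at h1
        rw [dist_eq_norm]
        have h2 := hb k l z (Metric.mem_closedBall_self hR.le)
        nlinarith [norm_nonneg (F k - F l)]
      obtain ⟨y, hy⟩ := cauchySeq_tendsto_of_complete this
      exact ⟨y, fun _ => hy⟩
    · exact ⟨0, fun h => absurd h hz⟩
  choose g hg using hlim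
  refine ⟨g, ?_, ?_⟩
  · intro z₀ hz₀
    obtain ⟨R, hR, hsub, C, hC, hb⟩ := hest z₀ hz₀
    have hsubU : Metric.ball z₀ (R / 2) ⊆ U :=
      (Metric.ball_subset_closedBall.trans
        (Metric.closedBall_subset_closedBall (by linarith))).trans hsub
    have hd : ∀ k, ∀ z ∈ U, DifferentiableAt ℂ (h k) z := fun k z hz =>
      (hh k z hz).differentiableAt (hU.mem_nhds hz)
    -- uniform Cauchy estimate for the derivatives
    have hfd : ∀ k l, ∀ z ∈ Metric.ball z₀ (R / 2),
        ‖fderiv ℂ (h k) z - fderiv ℂ (h l) z‖ ≤ 2 * (C * ‖F k - F l‖) / (R / 2) := by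
      intro k l z hz
      have hz2 : Metric.ball z (R / 2) ⊆ Metric.closedBall z₀ R := by
        refine Metric.ball_subset_closedBall.trans (Metric.closedBall_subset_closedBall' ?_)
        have := Metric.mem_ball.1 hz
        linarith
      rw [← fderiv_sub (hd k z (hsubU hz)) (hd l z (hsubU hz))]
      refine fderiv_norm_le (half_pos hR) ?_ ?_
      · exact ((hh k).sub (hh l)).mono (hz2.trans hsub)
      · intro w hw
        exact hb k l w (hz2 hw)
    have huc : UniformCauchySeqOn (fun k => fderiv ℂ (h k)) Filter.atTop
        (Metric.ball z₀ (R / 2)) := by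
      rw [Metric.uniformCauchySeqOn_iff]
      intro δ hδ
      rw [Metric.cauchySeq_iff] at hcau
      obtain ⟨N, hN⟩ := hcau (δ * (R / 2) / (2 * (C + 1))) (by positivity)
      refine ⟨N, fun k hk l hl z hz => ?_⟩
      have h1 := hN k hk l hl
      rw [dist_eq_norm, lt_div_iff₀ (by positivity)] at h1
      rw [dist_eq_norm]
      refine (hfd k l z hz).trans_lt ?_
      rw [div_lt_iff₀ (half_pos hR)]
      nlinarith [norm_nonneg (F k - F l)]
    have hlim' : ∀ z, ∃ y, z ∈ Metric.ball z₀ (R / 2) →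
        Filter.Tendsto (fun k => fderiv ℂ (h k) z) Filter.atTop (nhds y) := by
      intro z
      by_cases hz : z ∈ Metric.ball z₀ (R / 2)
      · obtain ⟨y, hy⟩ := cauchySeq_tendsto_of_complete (huc.cauchySeq hz)
        exact ⟨y, fun _ => hy⟩
      · exact ⟨0, fun h => absurd h hz⟩
    choose g' hg' using hlim'
    have htu : TendstoUniformlyOn (fun k => fderiv ℂ (h k)) g' Filter.atTop
        (Metric.ball z₀ (R / 2)) := huc.tendstoUniformlyOn_of_tendsto hg'
    have := hasFDerivAt_of_tendstoUniformlyOn Metric.isOpen_ball htu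
      (fun k z hz => (hd k z (hsubU hz)).hasFDerivAt) (fun z hz => hg z (hsubU hz))
      (Metric.mem_ball_self (half_pos hR))
    exact this.differentiableAt.differentiableWithinAt
  · obtain ⟨φ, hφ, hae⟩ := (tendstoInMeasure_of_tendsto_Lp hFG).exists_seq_tendsto_ae
    have hU' : ∀ᵐ z ∂v, z ∈ U := hvU
    filter_upwards [hae, ae_all_iff.2 hFh, hU'] with z hz1 hz2 hz3
    simp only [hz2] at hz1
    exact tendsto_nhds_unique hz1 ((hg z hz3).comp hφ.tendsto_atTop)

/-- The Cartan domain of type IV. -/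
def domain (n : ℕ) : Set (Fin n → ℂ) :=
  {z | ∑ i, ‖z i‖ ^ 2 < 1 ∧ 2 * ∑ i, ‖z i‖ ^ 2 < 1 + ‖z ⬝ᵥ z‖ ^ 2}

/-- `Δ(z) = 1 - 2|z|² + |zᵀz|²`. -/
def Delta {n : ℕ} (z : Fin n → ℂ) : ℝ := 1 - 2 * ∑ i, ‖z i‖ ^ 2 + ‖z ⬝ᵥ z‖ ^ 2

/-- `Δ(z)^(lam - n) dv(z)` on the domain, with unnormalized Lebesgue measure. -/
def weighted (n : ℕ) (lam : ℝ) : Measure (Fin n → ℂ) :=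
  (volume.restrict (domain n)).withDensity fun z => ENNReal.ofReal (Delta z ^ (lam - n))

/-- The weighted measure, normalized to total mass `1` (for `lam > n - 1` the total mass of
`weighted n lam` is positive and finite); normalizing Lebesgue measure beforehand makes no
difference. -/
def vMeasure (n : ℕ) (lam : ℝ) : Measure (Fin n → ℂ) :=
  (weighted n lam Set.univ)⁻¹ • weighted n lam

theorem isOpen_domain (n : ℕ) : IsOpen (domain n) := by
  simp only [domain, dotProduct]
  apply IsOpen.and
  · exact isOpen_lt (by fun_prop) (by fun_prop)
  · exact isOpen_lt (by fun_prop) (by fun_prop)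

theorem continuous_Delta (n : ℕ) : Continuous (Delta (n := n)) := by
  unfold Delta dotProduct
  fun_prop

theorem Delta_pos {n : ℕ} {z : Fin n → ℂ} (hz : z ∈ domain n) : 0 < Delta z := by
  have := hz.2
  unfold Delta
  linarith

theorem vMeasure_compl (n : ℕ) (lam : ℝ) : vMeasure n lam (domain n)ᶜ = 0 := by
  have h : weighted n lam ≪ volume.restrict (domain n) := withDensity_absolutelyContinuous _ _
  have h' : weighted n lam (domain n)ᶜ = 0 := by
    apply h
    rw [Measure.restrict_apply (isOpen_domain n).measurableSet.compl]
    simp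
  rw [vMeasure, Measure.smul_apply, h', smul_zero]

theorem isClosed_bergman (n : ℕ) (lam : ℝ) :
    IsClosed (holoL2 (domain n) (vMeasure n lam) : Set (Lp ℂ 2 (vMeasure n lam))) := by
  by_cases h0 : (weighted n lam Set.univ)⁻¹ = 0
  · have : vMeasure n lam = 0 := by rw [vMeasure, h0, zero_smul]
    have hz : ∀ F : Lp ℂ 2 (vMeasure n lam), F = 0 := by
      intro F
      apply Lp.ext
      have hae : ae (vMeasure n lam) = ⊥ := by rw [this, ae_zero]
      rw [Filter.EventuallyEq, Filter.Eventually, hae]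
      exact Filter.mem_bot
    have : (holoL2 (domain n) (vMeasure n lam) : Set (Lp ℂ 2 (vMeasure n lam))) = Set.univ := by
      ext F
      simp [hz F]
    rw [this]
    exact isClosed_univ
  refine isClosed_holoL2 (isOpen_domain n) (vMeasure_compl n lam) ?_
  intro z₀ hz₀
  obtain ⟨R, hR, hsub⟩ := Metric.nhds_basis_closedBall.mem_iff.1 ((isOpen_domain n).mem_nhds hz₀)
  have hcont : ContinuousOn (fun z : Fin n → ℂ => Delta z ^ (lam - n)) (Metric.closedBall z₀ R) :=
    fun z hz => ((continuous_Delta n).continuousAt.rpow_const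
      (Or.inl (Delta_pos (hsub hz)).ne')).continuousWithinAt
  obtain ⟨z₁, hz₁, hmin⟩ := (isCompact_closedBall z₀ R).exists_isMinOn
    ⟨z₀, Metric.mem_closedBall_self hR.le⟩ hcont
  set m : ℝ := Delta z₁ ^ (lam - n)
  have hm : 0 < m := Real.rpow_pos_of_pos (Delta_pos (hsub hz₁)) _
  set c : ℝ≥0∞ := min 1 (weighted n lam Set.univ)⁻¹
  have hc0 : c ≠ 0 := by
    simp only [c]
    rcases min_choice 1 (weighted n lam Set.univ)⁻¹ with h | h <;> rw [h]
    · exact one_ne_zero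
    · exact h0
  have hct : c ≠ ∞ := ne_top_of_le_ne_top ENNReal.one_ne_top (min_le_left _ _)
  refine ⟨R, hR, c * ENNReal.ofReal m, mul_ne_zero hc0 (by simpa using hm),
    ENNReal.mul_ne_top hct ENNReal.ofReal_ne_top, hsub, ?_⟩
  have h1 : ENNReal.ofReal m • volume.restrict (Metric.closedBall z₀ R) ≤ weighted n lam := by
    rw [Measure.le_iff]
    intro s hs
    rw [weighted, withDensity_apply _ hs, Measure.restrict_restrict hs, Measure.smul_apply,
      Measure.restrict_apply hs, smul_eq_mul]
    calc ENNReal.ofReal m * volume (s ∩ Metric.closedBall z₀ R)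
        = ∫⁻ z in s ∩ Metric.closedBall z₀ R, ENNReal.ofReal m := by rw [setLIntegral_const]
      _ ≤ ∫⁻ z in s ∩ Metric.closedBall z₀ R, ENNReal.ofReal (Delta z ^ (lam - n)) :=
          setLIntegral_mono' (hs.inter Metric.isClosed_closedBall.measurableSet)
            fun z hz => ENNReal.ofReal_le_ofReal (hmin hz.2)
      _ ≤ _ := lintegral_mono_set (Set.inter_subset_inter_right s hsub)
  rw [mul_smul, vMeasure]
  rw [Measure.le_iff] at h1 ⊢
  intro s hs
  rw [Measure.smul_apply, Measure.smul_apply]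
  exact mul_le_mul' (min_le_right _ _) (h1 s hs)

/-- The weighted Bergman space as a subspace of `L²`. -/
def bergman (n : ℕ) (lam : ℝ) : Submodule ℂ (Lp ℂ 2 (vMeasure n lam)) :=
  holoL2 (domain n) (vMeasure n lam)


/-- The weighted Bergman space as a Hilbert space. -/
def BergmanSpace (n : ℕ) (lam : ℝ) : Type := bergman n lam

instance (n : ℕ) (lam : ℝ) : NormedAddCommGroup (BergmanSpace n lam) :=
  inferInstanceAs (NormedAddCommGroup (bergman n lam))

instance (n : ℕ) (lam : ℝ) : InnerProductSpace ℂ (BergmanSpace n lam) :=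
  inferInstanceAs (InnerProductSpace ℂ (bergman n lam))

instance (n : ℕ) (lam : ℝ) : CompleteSpace (BergmanSpace n lam) :=
  (isClosed_bergman n lam).completeSpace_coe

/-- The inclusion of the Bergman space in `L²`. -/
def bergmanIncl (n : ℕ) (lam : ℝ) : BergmanSpace n lam →ₗᵢ[ℂ] Lp ℂ 2 (vMeasure n lam) :=
  (bergman n lam).subtypeₗᵢ

/-- The Bergman projection, the orthogonal projection of `L²` onto the Bergman space. -/
def bergmanProj (n : ℕ) (lam : ℝ) : Lp ℂ 2 (vMeasure n lam) →L[ℂ] BergmanSpace n lam :=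
  haveI : CompleteSpace (bergman n lam) := (isClosed_bergman n lam).completeSpace_coe
  (bergman n lam).orthogonalProjectionOnto

/-- The multiplication operator `M_a` on `L²`. -/
def mulOp (n : ℕ) (lam : ℝ) (a : Lp ℂ ∞ (vMeasure n lam)) :
    Lp ℂ 2 (vMeasure n lam) →L[ℂ] Lp ℂ 2 (vMeasure n lam) :=
  (ContinuousLinearMap.mul ℂ ℂ).holderL (vMeasure n lam) ∞ 2 2 a

/-- The Toeplitz operator `T_a = B ∘ M_a` on the Bergman space. -/
def toeplitz (n : ℕ) (lam : ℝ) (a : Lp ℂ ∞ (vMeasure n lam)) :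
    BergmanSpace n lam →L[ℂ] BergmanSpace n lam :=
  bergmanProj n lam ∘L mulOp n lam a ∘L (bergmanIncl n lam).toContinuousLinearMap

/-- The `H`-invariant symbols `L^∞(D)^H`: the classes `a` with `a ∘ h⁻¹ = a` almost everywhere
for every `h ∈ H`. -/
def invariantSymbols (n : ℕ) (lam : ℝ) (H : Subgroup (K n)) : Set (Lp ℂ ∞ (vMeasure n lam)) :=
  {a | ∀ h ∈ H, (fun z => a (act h⁻¹ z)) =ᵐ[vMeasure n lam] a}

/-- The unital Banach algebra generated by the Toeplitz operators with symbols in `S`: the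
operator-norm closure of the unital algebra they generate. -/
def toeplitzAlgebra (n : ℕ) (lam : ℝ) (S : Set (Lp ℂ ∞ (vMeasure n lam))) :
    Subalgebra ℂ (BergmanSpace n lam →L[ℂ] BergmanSpace n lam) :=
  (Algebra.adjoin ℂ (toeplitz n lam '' S)).topologicalClosure

/-- `B` is a (unital) C⋆-subalgebra of `A`: norm closed and closed under adjoints. -/
def IsCStarSubalgebra {A : Type*} [CStarAlgebra A] (B : Subalgebra ℂ A) : Prop :=
  IsClosed (B : Set A) ∧ ∀ T ∈ B, star T ∈ B

/-- Any two elements of `B` commute. -/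
def IsCommutativeSubalgebra {A : Type*} [CStarAlgebra A] (B : Subalgebra ℂ A) : Prop :=
  ∀ S ∈ B, ∀ T ∈ B, S * T = T * S

end CartanIV

end

/-!
For `n ≥ 3` every `z : ℂⁿ` can be moved to its complex conjugate by `SO(n) × SO(2)`. Hence, for a
bounded operator `S` on the Bergman space that commutes with this group, the function
`⟪k_w, S k_z⟫` of the reproducing kernels takes the same value at `(z, z)` and at
`(conj z, conj z)`, and by polarization `S` is symmetric for the bilinear form
`(f, g) ↦ ⟪conj f, g⟫`, where `conj f = conj ∘ f ∘ conj`. Operators `S`, `T` such that `S`, `T` and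
`S T` are all symmetric commute.

A group `H` containing `SO(2)` and preserving a proper partial sum of squares `∑ i ∈ I, z i ^ 2` has
at least two independent semi-invariants of degree two: this sum and `zᵀz`. The Toeplitz algebra
preserves the space of all such semi-invariants, which has finite dimension. If the algebra were
commutative, this space would contain nonzero `f`, `h` with `⟪h, T f⟫ = 0` for all `T` in the
algebra. The symbol `conj (f z) * h z` is `H`-invariant, and its Toeplitz operator gives
`∫ |f h|² = 0`, which is impossible.

Finiteness of the weighted measure for `lam > n - 1` follows in the coordinates `z₀ ± i z₁`, in
which `1 - 2 |z|² + |zᵀz|²` is a paraboloid on every complex line parallel to the first axis.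
-/

noncomputable section

open Metric Filter
open scoped InnerProductSpace

namespace CartanIV

/-! ### Holomorphic functions -/

theorem convex_preimage_line {E : Type*} [AddCommGroup E] [Module ℂ E] {C : Set E}
    (hC : Convex ℝ C) (a b : E) : Convex ℝ ((fun s : ℂ => a + s • b) ⁻¹' C) :=
  (hC.translate_preimage_right a).linear_preimage
    ((LinearMap.toSpanSingleton ℂ E b).restrictScalars ℝ)

section Holomorphic

variable {E F : Type*} [NormedAddCommGroup E] [NormedSpace ℂ E] [NormedAddCommGroup F]
  [NormedSpace ℂ F]

theorem exists_norm_le_of_weakly_continuousOn {X : Type*} [TopologicalSpace X] {φ : X → F}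
    {K : Set X} (hK : IsCompact K)
    (hφ : ∀ ℓ : StrongDual ℂ F, ContinuousOn (fun s => ℓ (φ s)) K) :
    ∃ M, ∀ s ∈ K, ‖φ s‖ ≤ M := by
  obtain ⟨M, hM⟩ := banach_steinhaus
    (g := fun s : K => NormedSpace.inclusionInDoubleDual ℂ F (φ s)) fun ℓ => by
      obtain ⟨C, hC⟩ := hK.exists_bound_of_continuousOn (hφ ℓ)
      exact ⟨C, fun s => hC s s.2⟩
  refine ⟨M, fun s hs => ?_⟩
  rw [← (NormedSpace.inclusionInDoubleDualLi ℂ (E := F)).norm_map (φ s)]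
  exact hM ⟨s, hs⟩

theorem continuousAt_of_weakly_differentiableOn [ProperSpace E] {φ : E → F} {s₀ : E} {r : ℝ}
    (hr : 0 < r)
    (hφ : ∀ ℓ : StrongDual ℂ F, DifferentiableOn ℂ (fun s => ℓ (φ s)) (closedBall s₀ r)) :
    ContinuousAt φ s₀ := by
  obtain ⟨M, hM⟩ := exists_norm_le_of_weakly_continuousOn (isCompact_closedBall s₀ r)
    fun ℓ => (hφ ℓ).continuousOn
  have hM0 : 0 ≤ M := (norm_nonneg _).trans (hM s₀ (mem_closedBall_self hr.le))
  -- The Schwarz lemma gives a Lipschitz bound at `s₀` that is uniform in the functional.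
  have hlip : ∀ s ∈ ball s₀ r, ‖φ s - φ s₀‖ ≤ 2 * M / r * dist s s₀ := by
    intro s hs
    refine NormedSpace.norm_le_dual_bound ℂ _ (by positivity) fun ℓ => ?_
    have hmaps : Set.MapsTo (fun s => ℓ (φ s)) (ball s₀ r)
        (closedBall (ℓ (φ s₀)) (2 * M * ‖ℓ‖)) := by
      intro t ht
      rw [mem_closedBall, dist_eq_norm, ← map_sub]
      calc ‖ℓ (φ t - φ s₀)‖ ≤ ‖ℓ‖ * (‖φ t‖ + ‖φ s₀‖) :=
            (ℓ.le_opNorm _).trans (by gcongr; exact norm_sub_le _ _)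
        _ ≤ ‖ℓ‖ * (M + M) := by
            gcongr
            · exact hM t (ball_subset_closedBall ht)
            · exact hM s₀ (mem_closedBall_self hr.le)
        _ = 2 * M * ‖ℓ‖ := by ring
    have hschwarz := Complex.dist_le_div_mul_dist_of_mapsTo_ball
      ((hφ ℓ).mono ball_subset_closedBall) hmaps hs
    rw [dist_eq_norm, ← map_sub] at hschwarz
    exact hschwarz.trans_eq (by ring)
  rw [ContinuousAt, tendsto_iff_norm_sub_tendsto_zero]
  refine squeeze_zero' (Eventually.of_forall fun _ => norm_nonneg _)
    (eventually_of_mem (ball_mem_nhds s₀ hr) hlip) ?_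
  have : Continuous fun s => 2 * M / r * dist s s₀ := by fun_prop
  simpa using this.tendsto s₀

variable [CompleteSpace F]

theorem eqOn_zero_ball_of_eventuallyEq_zero {f : E → F} {z w : E} {r : ℝ}
    (hf : DifferentiableOn ℂ f (ball z r)) (hw : w ∈ ball z r) (hfw : f =ᶠ[nhds w] 0) :
    Set.EqOn f 0 (ball z r) := by
  intro y hy
  let ℓ : ℂ → E := fun s => w + s • (y - w)
  have hℓ : Differentiable ℂ ℓ := by fun_prop
  have hℓ0 : ℓ 0 = w := by simp [ℓ]
  have hℓ1 : ℓ 1 = y := by simp [ℓ]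
  have hana : AnalyticOnNhd ℂ (f ∘ ℓ) (ℓ ⁻¹' ball z r) :=
    (hf.comp hℓ.differentiableOn fun _ hs => hs).analyticOnNhd (isOpen_ball.preimage hℓ.continuous)
  have hzero : f ∘ ℓ =ᶠ[nhds 0] 0 := (hℓ.continuous.tendsto' 0 w hℓ0).eventually hfw
  have h0 : (0 : ℂ) ∈ ℓ ⁻¹' ball z r := by rwa [Set.mem_preimage, hℓ0]
  have h1 : (1 : ℂ) ∈ ℓ ⁻¹' ball z r := by rwa [Set.mem_preimage, hℓ1]
  simpa [hℓ1] using hana.eqOn_zero_of_preconnected_of_eventuallyEq_zero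
    (convex_preimage_line (convex_ball z r) w (y - w)).isPreconnected h0 hzero h1

theorem eqOn_zero_of_isPreconnected_of_eventuallyEq_zero {U : Set E} (hU : IsOpen U)
    (hUc : IsPreconnected U) {f : E → F} (hf : DifferentiableOn ℂ f U) {z : E} (hz : z ∈ U)
    (hfz : f =ᶠ[nhds z] 0) : Set.EqOn f 0 U := by
  suffices h : U ⊆ {w | f =ᶠ[nhds w] 0} from fun w hw => (h hw).eq_of_nhds
  refine hUc.subset_of_closure_inter_subset isOpen_setOfPred_eventually_nhds ⟨z, hz, hfz⟩ ?_
  rintro w ⟨hw, hwU⟩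
  obtain ⟨r, hr, hrU⟩ := isOpen_iff.1 hU w hwU
  obtain ⟨y, hfy, hy⟩ := mem_closure_iff.1 hw r hr
  have hzero := eqOn_zero_ball_of_eventuallyEq_zero (hf.mono hrU) (mem_ball'.2 hy) hfy
  exact hzero.eventuallyEq_of_mem (ball_mem_nhds w hr)

theorem eqOn_zero_or_eqOn_zero_of_mul_eqOn_zero {U : Set E} (hU : IsOpen U)
    (hUc : IsPreconnected U) {f g : E → ℂ} (hf : DifferentiableOn ℂ f U)
    (hg : DifferentiableOn ℂ g U) (hfg : Set.EqOn (f * g) 0 U) :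
    Set.EqOn f 0 U ∨ Set.EqOn g 0 U := by
  refine or_iff_not_imp_left.2 fun hf0 => ?_
  obtain ⟨z, hz, hfz⟩ : ∃ z ∈ U, f z ≠ 0 := by simpa [Set.EqOn] using hf0
  have hfz' : ∀ᶠ w in nhds z, f w ≠ 0 :=
    (hf.differentiableAt (hU.mem_nhds hz)).continuousAt.eventually_ne hfz
  refine eqOn_zero_of_isPreconnected_of_eventuallyEq_zero hU hUc hg hz ?_
  filter_upwards [hfz', hU.mem_nhds hz] with w hw hwU
  exact (mul_eq_zero.1 (hfg hwU)).resolve_left hw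

/-- Dunford's theorem. -/
theorem differentiableOn_of_weakly_differentiableOn {φ : ℂ → F} {U : Set ℂ} (hU : IsOpen U)
    (hφ : ∀ ℓ : StrongDual ℂ F, DifferentiableOn ℂ (fun s => ℓ (φ s)) U) :
    DifferentiableOn ℂ φ U := by
  have hcont : ContinuousOn φ U := fun s hs => by
    obtain ⟨r, hr, hrU⟩ := nhds_basis_closedBall.mem_iff.1 (hU.mem_nhds hs)
    exact (continuousAt_of_weakly_differentiableOn hr fun ℓ =>
      (hφ ℓ).mono hrU).continuousWithinAt
  intro s₀ hs₀
  obtain ⟨r, hr, hrU⟩ := nhds_basis_closedBall.mem_iff.1 (hU.mem_nhds hs₀)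
  lift r to NNReal using hr.le
  have hsphere : ContinuousOn φ (sphere s₀ r) := hcont.mono (sphere_subset_closedBall.trans hrU)
  have hcauchy : ∀ s ∈ ball s₀ r,
      φ s = (2 * Real.pi * Complex.I : ℂ)⁻¹ • ∮ z in C(s₀, r), (z - s)⁻¹ • φ z := by
    intro s hs
    have hne : ∀ z ∈ sphere s₀ r, z - s ≠ 0 := fun z hz =>
      sub_ne_zero.2 (ne_of_mem_of_not_mem hz fun h => (mem_ball.1 hs).ne (mem_sphere.1 h))
    have hint : ContinuousOn (fun z => (z - s)⁻¹ • φ z) (sphere s₀ r) :=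
      (ContinuousOn.inv₀ (by fun_prop) hne).smul hsphere
    refine (eq_inv_smul_iff₀ Complex.two_pi_I_ne_zero).2
      ((SeparatingDual.eq_iff_forall_dual_eq (R := ℂ)).2 fun ℓ => ?_)
    have hscalar := ((hφ ℓ).mono hrU).circleIntegral_sub_inv_smul hs
    rw [map_smul, ← hscalar]
    simp only [circleIntegral]
    rw [← ContinuousLinearMap.intervalIntegral_comp_comm]
    · simp
    · exact (hint.circleIntegrable r.2).out
  exact ((hasFPowerSeriesOn_cauchy_integral (hsphere.circleIntegrable r.2)
    hr).analyticAt.differentiableAt.congr_of_eventuallyEq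
      (eventually_of_mem (ball_mem_nhds s₀ hr) hcauchy)).differentiableWithinAt

end Holomorphic

section Polarization

variable {E F : Type*} [NormedAddCommGroup E] [NormedSpace ℂ E] [StarAddMonoid E]
  [NormedStarGroup E] [StarModule ℂ E] [NormedAddCommGroup F] [NormedSpace ℂ F] [CompleteSpace F]

theorem exists_add_I_smul_eq_and_star (w u : E) :
    ∃ p q : E, p + Complex.I • q = w ∧ star p + Complex.I • star q = u ∧
      ‖p‖ ≤ max ‖w‖ ‖u‖ := by
  refine ⟨(2⁻¹ : ℂ) • (w + star u), (-Complex.I / 2) • (w - star u), ?_, ?_, ?_⟩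
  · have hI : Complex.I * (-Complex.I / 2) = 2⁻¹ := by
      linear_combination (-2⁻¹ : ℂ) * Complex.I_sq
    rw [smul_smul, hI]
    module
  · have hI : Complex.I * star (-Complex.I / 2) = -2⁻¹ := by
      simp only [Complex.star_def, map_div₀, map_neg, Complex.conj_I, Complex.conj_ofNat, neg_neg]
      linear_combination (2⁻¹ : ℂ) * Complex.I_sq
    have h2 : star (2⁻¹ : ℂ) = 2⁻¹ := by simp
    rw [star_smul, star_smul, star_add, star_sub, star_star, smul_smul, hI, h2]
    module
  · rw [norm_smul, norm_inv, Complex.norm_ofNat, inv_mul_le_iff₀ two_pos]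
    have h1 := norm_add_le w (star u)
    rw [norm_star] at h1
    linarith [le_max_left ‖w‖ ‖u‖, le_max_right ‖w‖ ‖u‖]

theorem eq_zero_of_forall_apply_star_eq_zero {Φ : E → E → F} {R : ℝ}
    (hΦ : ∀ a b c d : E, DifferentiableOn ℂ (fun s : ℂ => Φ (a + s • b) (c + s • d))
      ((fun s : ℂ => a + s • b) ⁻¹' ball 0 R ∩ (fun s : ℂ => c + s • d) ⁻¹' ball 0 R))
    (hdiag : ∀ z ∈ ball (0 : E) R, Φ z (star z) = 0) {w u : E} (hw : w ∈ ball 0 R)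
    (hu : u ∈ ball 0 R) : Φ w u = 0 := by
  -- The complex line `s ↦ (p + s q, star p + s star q)` passes through `(w, u)` at `s = I`, and
  -- its points with real parameter have the form `(z, star z)`.
  obtain ⟨p, q, hwI, huI, hpmax⟩ := exists_add_I_smul_eq_and_star w u
  let V : Set ℂ :=
    (fun s : ℂ => p + s • q) ⁻¹' ball 0 R ∩ (fun s : ℂ => star p + s • star q) ⁻¹' ball 0 R
  have hp : ‖p‖ < R := hpmax.trans_lt (max_lt (by simpa using hw) (by simpa using hu))
  have hVopen : IsOpen V :=
    (isOpen_ball.preimage (by fun_prop)).inter (isOpen_ball.preimage (by fun_prop))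
  have hVconv : Convex ℝ V :=
    (convex_preimage_line (convex_ball (0 : E) R) p q).inter
      (convex_preimage_line (convex_ball (0 : E) R) (star p) (star q))
  have h0V : (0 : ℂ) ∈ V := by simpa [V] using hp
  have hIV : Complex.I ∈ V :=
    ⟨by simpa only [Set.mem_preimage, hwI], by simpa only [Set.mem_preimage, huI]⟩
  have hreal : ∃ᶠ s in nhdsWithin (0 : ℂ) {0}ᶜ, Φ (p + s • q) (star p + s • star q) = 0 := by
    have hnear : ∀ᶠ t : ℝ in nhdsWithin 0 {0}ᶜ, (t : ℂ) ∈ V :=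
      (Complex.continuous_ofReal.tendsto' 0 0 rfl).eventually (hVopen.mem_nhds h0V)
        |>.filter_mono nhdsWithin_le_nhds
    have hmap : Tendsto ((↑) : ℝ → ℂ) (nhdsWithin 0 {0}ᶜ) (nhdsWithin 0 {0}ᶜ) :=
      Complex.continuous_ofReal.continuousWithinAt.tendsto_nhdsWithin fun t ht => by simpa using ht
    refine hmap.frequently (hnear.mono fun t ht => ?_).frequently
    have := hdiag _ ht.1
    simpa [star_add, star_smul] using this
  have := ((hΦ p q (star p) (star q)).analyticOnNhd hVopen)
    |>.eqOn_zero_of_preconnected_of_frequently_eq_zero hVconv.isPreconnected h0V hreal hIV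
  simpa only [hwI, huI, Pi.zero_apply] using this

end Polarization

/-! ### Finiteness of the weighted measure -/

section Paraboloid

variable {s : ℝ}

theorem integrableOn_ball_one_sub_norm_sq_rpow {E : Type*} [NormedAddCommGroup E]
    [NormedSpace ℝ E] [FiniteDimensional ℝ E] [Nontrivial E] [MeasurableSpace E] [BorelSpace E]
    (μ : Measure E) [μ.IsAddHaarMeasure] (hs : -1 < s) :
    IntegrableOn (fun x : E => (1 - ‖x‖ ^ 2) ^ s) (ball 0 1) μ := by
  rw [integrableOn_fun_norm_addHaar μ (f := fun r => (1 - r ^ 2) ^ s),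
    ← intervalIntegrable_iff_integrableOn_Ioo_of_le zero_le_one]
  have hsing : IntervalIntegrable (fun r : ℝ => (1 - r) ^ s) volume 0 1 := by
    simpa using ((intervalIntegral.intervalIntegrable_rpow' (a := 0) (b := 1) hs).comp_sub_left
      1).symm
  have hreg : ContinuousOn (fun r : ℝ => r ^ (Module.finrank ℝ E - 1) * (1 + r) ^ s)
      (Set.uIcc 0 1) := by
    rw [Set.uIcc_of_le zero_le_one]
    exact (continuousOn_id.pow _).mul <| (continuousOn_const.add continuousOn_id).rpow_const
      fun r hr => Or.inl (by linarith [hr.1] : (0 : ℝ) < 1 + r).ne'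
  refine (hsing.mul_continuousOn hreg).congr_ae ?_
  rw [Set.uIoc_of_le zero_le_one]
  filter_upwards [ae_restrict_mem measurableSet_Ioc] with r hr
  rw [smul_eq_mul, show 1 - r ^ 2 = (1 - r) * (1 + r) by ring,
    Real.mul_rpow (by linarith [hr.2]) (by linarith [hr.1])]
  ring

theorem setLIntegral_ball_one_sub_norm_sq_rpow_lt_top (hs : -1 < s) :
    ∫⁻ ζ in ball (0 : ℂ) 1, ENNReal.ofReal ((1 - ‖ζ‖ ^ 2) ^ s) < ∞ := by
  refine (hasFiniteIntegral_iff_ofReal ?_).1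
    (integrableOn_ball_one_sub_norm_sq_rpow (volume : Measure ℂ) hs).2
  filter_upwards [ae_restrict_mem measurableSet_ball] with ζ hζ
  have := mem_ball_zero_iff.1 hζ
  exact Real.rpow_nonneg (by nlinarith [norm_nonneg ζ]) _

theorem lintegral_eq_ofReal_pow_mul_lintegral_smul {E : Type*} [NormedAddCommGroup E]
    [NormedSpace ℝ E] [FiniteDimensional ℝ E] [MeasurableSpace E] [BorelSpace E]
    (μ : Measure E) [μ.IsAddHaarMeasure] (f : E → ℝ≥0∞) {R : ℝ} (hR : 0 < R) :
    ∫⁻ x, f x ∂μ = ENNReal.ofReal (R ^ Module.finrank ℝ E) * ∫⁻ x, f (R • x) ∂μ := by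
  have hmap : ∫⁻ x, f x ∂(μ.map (R • ·)) = ∫⁻ x, f (R • x) ∂μ :=
    (Homeomorph.smulOfNeZero R hR.ne').measurableEmbedding.lintegral_map f
  rw [← hmap, Measure.map_addHaar_smul μ hR.ne', lintegral_smul_measure, smul_eq_mul, ← mul_assoc,
    ← ENNReal.ofReal_mul (by positivity), abs_of_pos (by positivity),
    mul_inv_cancel₀ (by positivity), ENNReal.ofReal_one, one_mul]

theorem setLIntegral_paraboloid_rpow_le (hs : -1 < s) {p R : ℝ} (hp : 0 < p) (hR : R ≤ 1)
    (c : ℂ) :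
    ∫⁻ ζ in ball c R, ENNReal.ofReal ((p * (R ^ 2 - ‖ζ - c‖ ^ 2)) ^ s) ≤
      ENNReal.ofReal (p ^ s) * ∫⁻ ζ in ball (0 : ℂ) 1, ENNReal.ofReal ((1 - ‖ζ‖ ^ 2) ^ s) := by
  obtain hR0 | hR0 := le_or_gt R 0
  · simp [ball_eq_empty.2 hR0]
  set f : ℂ → ℝ≥0∞ := (ball 0 R).indicator
    fun ζ => ENNReal.ofReal ((p * (R ^ 2 - ‖ζ‖ ^ 2)) ^ s) with hf
  have hscale (ζ : ℂ) : f (R • ζ) = ENNReal.ofReal ((p * R ^ 2) ^ s) *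
      (ball 0 1).indicator (fun ζ => ENNReal.ofReal ((1 - ‖ζ‖ ^ 2) ^ s)) ζ := by
    by_cases hζ : ‖ζ‖ < 1
    · have hRζ : R * ‖ζ‖ < R := by nlinarith
      have : 0 ≤ 1 - ‖ζ‖ ^ 2 := by nlinarith [norm_nonneg ζ]
      simp only [hf, Set.indicator, mem_ball_zero_iff, norm_smul, Real.norm_eq_abs,
        abs_of_pos hR0, hRζ, hζ, if_true]
      rw [← ENNReal.ofReal_mul (by positivity), ← Real.mul_rpow (by positivity) this]
      congr 2
      ring
    · have hRζ : ¬ R * ‖ζ‖ < R := by nlinarith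
      simp [hf, Set.indicator, abs_of_pos hR0, hRζ, hζ]
  have hpow : R ^ 2 * (p * R ^ 2) ^ s ≤ p ^ s := by
    rw [Real.mul_rpow hp.le (by positivity), mul_left_comm, ← Real.rpow_one_add' (by positivity)
      (by linarith)]
    exact mul_le_of_le_one_right (by positivity)
      (Real.rpow_le_one (by positivity) (by nlinarith) (by linarith))
  calc ∫⁻ ζ in ball c R, ENNReal.ofReal ((p * (R ^ 2 - ‖ζ - c‖ ^ 2)) ^ s)
      = ∫⁻ ζ, f (ζ - c) := by
        rw [← lintegral_indicator measurableSet_ball]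
        simp [hf, Set.indicator, dist_eq_norm]
    _ = ENNReal.ofReal (R ^ 2 * (p * R ^ 2) ^ s) *
          ∫⁻ ζ in ball (0 : ℂ) 1, ENNReal.ofReal ((1 - ‖ζ‖ ^ 2) ^ s) := by
        rw [lintegral_sub_right_eq_self f, lintegral_eq_ofReal_pow_mul_lintegral_smul _ f hR0,
          Complex.finrank_real_complex]
        simp only [hscale]
        rw [lintegral_const_mul _ (Measurable.indicator (by fun_prop) measurableSet_ball),
          lintegral_indicator measurableSet_ball, ← mul_assoc, ← ENNReal.ofReal_mul (by positivity)]
    _ ≤ _ := by gcongr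

end Paraboloid

theorem norm_dotProduct_self_le {ι : Type*} [Fintype ι] (w : ι → ℂ) :
    ‖w ⬝ᵥ w‖ ≤ ∑ i, ‖w i‖ ^ 2 := by
  refine (norm_sum_le _ _).trans (le_of_eq ?_)
  simp [sq]

section IsotropicCoordinates

variable (m : ℕ)

/-- The coordinates `ζ = z₀ + i z₁`, `ω = z₀ - i z₁` on the first two factors, in which
`z₀² + z₁² = ζ ω`, so that `zᵀz` is affine in `ζ`. -/
def isotropicCoord : (ℂ × ℂ × (Fin m → ℂ)) ≃L[ℂ] (Fin (m + 2) → ℂ) :=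
  LinearEquiv.toContinuousLinearEquiv
    { toFun := fun x => vecCons ((x.1 + x.2.1) / 2)
        (vecCons (-Complex.I * (x.1 - x.2.1) / 2) x.2.2)
      map_add' x y := by
        refine funext (Fin.cases ?_ (Fin.cases ?_ fun _ => ?_)) <;> simp <;> ring
      map_smul' c x := by
        refine funext (Fin.cases ?_ (Fin.cases ?_ fun _ => ?_)) <;> simp <;> ring
      invFun := fun z => (z 0 + Complex.I * z 1, z 0 - Complex.I * z 1, fun i => z i.succ.succ)
      left_inv x := by
        ext <;> simp <;> ring_nf <;> (simp; ring)
      right_inv z := by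
        refine funext (Fin.cases ?_ (Fin.cases ?_ fun _ => rfl))
        · simp only [cons_val_zero]
          ring
        · simp only [Fin.succ_zero_eq_one, cons_val_one, cons_val_zero]
          linear_combination -z 1 * Complex.I_mul_I }

variable {m} (ζ ω : ℂ) (w : Fin m → ℂ)

theorem isotropicCoord_apply :
    isotropicCoord m (ζ, ω, w) =
      vecCons ((ζ + ω) / 2) (vecCons (-Complex.I * (ζ - ω) / 2) w) := rfl

theorem sum_norm_sq_isotropicCoord :
    ∑ i, ‖isotropicCoord m (ζ, ω, w) i‖ ^ 2 = (‖ζ‖ ^ 2 + ‖ω‖ ^ 2) / 2 + ∑ i, ‖w i‖ ^ 2 := by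
  simp only [isotropicCoord_apply, Fin.sum_univ_succ, cons_val_zero, cons_val_succ, norm_div,
    norm_mul, norm_neg, Complex.norm_I, ← add_assoc]
  congr 1
  simp only [div_pow, mul_pow, Complex.sq_norm, Complex.normSq_apply, Complex.norm_ofNat]
  simp
  ring

theorem dotProduct_isotropicCoord :
    isotropicCoord m (ζ, ω, w) ⬝ᵥ isotropicCoord m (ζ, ω, w) = ζ * ω + w ⬝ᵥ w := by
  simp only [isotropicCoord_apply, dotProduct, Fin.sum_univ_succ, cons_val_zero, cons_val_succ,
    ← add_assoc]
  congr 1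
  ring_nf
  simp
  ring

end IsotropicCoordinates

theorem complete_square {ζ ω q : ℂ} {b p : ℝ} (hp : 1 - ‖ω‖ ^ 2 = p) (hp0 : p ≠ 0) :
    1 - 2 * ((‖ζ‖ ^ 2 + ‖ω‖ ^ 2) / 2 + b) + ‖ζ * ω + q‖ ^ 2 =
      p * ((1 - 2 * b / p + (‖q‖ / p) ^ 2) - ‖ζ - starRingEnd ℂ ω * q / p‖ ^ 2) := by
  have hdiv : ‖ζ - starRingEnd ℂ ω * q / p‖ ^ 2 =
      ‖p * ζ - starRingEnd ℂ ω * q‖ ^ 2 / p ^ 2 := by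
    have : (p : ℂ) ≠ 0 := Complex.ofReal_ne_zero.2 hp0
    rw [← sq_abs p, ← Real.norm_eq_abs, ← Complex.norm_real, ← div_pow, ← norm_div]
    field_simp
  have hsub : ‖p * ζ - starRingEnd ℂ ω * q‖ ^ 2 =
      p ^ 2 * ‖ζ‖ ^ 2 - 2 * p * (ζ * ω * starRingEnd ℂ q).re + ‖ω‖ ^ 2 * ‖q‖ ^ 2 := by
    simp [Complex.sq_norm, Complex.normSq_apply]
    ring
  have hadd : ‖ζ * ω + q‖ ^ 2 =
      ‖ζ‖ ^ 2 * ‖ω‖ ^ 2 + 2 * (ζ * ω * starRingEnd ℂ q).re + ‖q‖ ^ 2 := by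
    simp [Complex.sq_norm, Complex.normSq_apply]
    ring
  rw [hdiv, hsub, hadd, ← sub_eq_iff_eq_add'.2 (sub_eq_iff_eq_add.1 hp)]
  field_simp
  ring

section FiberIntegral

variable {m : ℕ} {ζ ω : ℂ} {w : Fin m → ℂ}

theorem Delta_isotropicCoord {p : ℝ} (hp : 1 - ‖ω‖ ^ 2 = p) (hp0 : p ≠ 0) :
    Delta (isotropicCoord m (ζ, ω, w)) =
      p * ((1 - 2 * (∑ i, ‖w i‖ ^ 2) / p + (‖w ⬝ᵥ w‖ / p) ^ 2) -
        ‖ζ - starRingEnd ℂ ω * (w ⬝ᵥ w) / p‖ ^ 2) := by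
  rw [Delta, sum_norm_sq_isotropicCoord, dotProduct_isotropicCoord, complete_square hp hp0]

theorem norm_sq_add_sum_norm_sq_lt_one (h : isotropicCoord m (ζ, ω, w) ∈ domain (m + 2)) :
    ‖ω‖ ^ 2 + ∑ i, ‖w i‖ ^ 2 < 1 := by
  obtain ⟨hnorm, hcone⟩ := h
  rw [dotProduct_isotropicCoord] at hcone
  rw [sum_norm_sq_isotropicCoord] at hnorm hcone
  by_contra! hge
  set b := ∑ i, ‖w i‖ ^ 2
  have hb : 0 ≤ b := by positivity
  have hq : ‖ζ * ω + w ⬝ᵥ w‖ ≤ ‖ζ‖ * ‖ω‖ + b :=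
    (norm_add_le _ _).trans (by rw [norm_mul]; gcongr; exact norm_dotProduct_self_le w)
  have hq2 : ‖ζ * ω + w ⬝ᵥ w‖ ^ 2 ≤ (‖ζ‖ * ‖ω‖ + b) ^ 2 := by gcongr
  have hdiff : (1 - ((‖ζ‖ ^ 2 + ‖ω‖ ^ 2) / 2 + b)) ^ 2 ≤ ((‖ω‖ ^ 2 - ‖ζ‖ ^ 2) / 2) ^ 2 :=
    pow_le_pow_left₀ (by linarith) (by linarith) 2
  nlinarith [mul_nonneg hb (sq_nonneg (‖ζ‖ - ‖ω‖))]

theorem one_sub_add_div_sq_le_one {b p q : ℝ} (hq : 0 ≤ q) (hqb : q ≤ b) (hbp : b ≤ p)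
    (hp : 0 < p) : 1 - 2 * b / p + (q / p) ^ 2 ≤ 1 := by
  have hqp : (q / p) ^ 2 ≤ b / p :=
    calc (q / p) ^ 2 ≤ q / p :=
          pow_le_of_le_one (by positivity) ((div_le_one hp).2 (hqb.trans hbp)) two_ne_zero
      _ ≤ b / p := by gcongr
  have : 0 ≤ b / p := div_nonneg (hq.trans hqb) hp.le
  rw [mul_div_assoc]
  linarith

theorem lintegral_isotropicCoord_le {s : ℝ} (hs : -1 < s)
    (h : ‖ω‖ ^ 2 + ∑ i, ‖w i‖ ^ 2 < 1) :
    ∫⁻ ζ, (domain (m + 2)).indicator (fun z => ENNReal.ofReal (Delta z ^ s))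
        (isotropicCoord m (ζ, ω, w)) ≤
      ENNReal.ofReal ((1 - ‖ω‖ ^ 2) ^ s) *
        ∫⁻ ζ in ball (0 : ℂ) 1, ENNReal.ofReal ((1 - ‖ζ‖ ^ 2) ^ s) := by
  set p := 1 - ‖ω‖ ^ 2 with hp
  set A : ℝ := 1 - 2 * (∑ i, ‖w i‖ ^ 2) / p + (‖w ⬝ᵥ w‖ / p) ^ 2
  set c : ℂ := starRingEnd ℂ ω * (w ⬝ᵥ w) / p
  have hp0 : 0 < p := by
    have : 0 ≤ ∑ i, ‖w i‖ ^ 2 := by positivity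
    linarith
  have hA : A ≤ 1 :=
    one_sub_add_div_sq_le_one (norm_nonneg _) (norm_dotProduct_self_le w) (by linarith) hp0
  refine le_trans ?_ (setLIntegral_paraboloid_rpow_le hs hp0 (Real.sqrt_le_one.2 hA) c)
  rw [← lintegral_indicator measurableSet_ball]
  refine lintegral_mono fun ζ => ?_
  by_cases hz : isotropicCoord m (ζ, ω, w) ∈ domain (m + 2)
  swap
  · simp [Set.indicator_of_notMem hz]
  have hΔ : Delta (isotropicCoord m (ζ, ω, w)) = p * (A - ‖ζ - c‖ ^ 2) :=
    Delta_isotropicCoord hp.symm hp0.ne'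
  have hpos : 0 < A - ‖ζ - c‖ ^ 2 := pos_of_mul_pos_right (hΔ ▸ Delta_pos hz) hp0.le
  have hζ : ζ ∈ ball c (Real.sqrt A) := by
    rw [mem_ball, dist_eq_norm]
    exact Real.lt_sqrt_of_sq_lt (by linarith)
  have hA0 : 0 ≤ A := by nlinarith [sq_nonneg ‖ζ - c‖]
  simp only [Set.indicator_of_mem hz, Set.indicator_of_mem hζ, hΔ, Real.sq_sqrt hA0, le_refl]

theorem lintegral_isotropicCoord_le_mul_indicator {s : ℝ} (hs : -1 < s) (ω : ℂ) (w : Fin m → ℂ) :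
    ∫⁻ ζ, (domain (m + 2)).indicator (fun z => ENNReal.ofReal (Delta z ^ s))
        (isotropicCoord m (ζ, ω, w)) ≤
      (ball 0 1).indicator (fun ω => ENNReal.ofReal ((1 - ‖ω‖ ^ 2) ^ s) *
        ∫⁻ ζ in ball (0 : ℂ) 1, ENNReal.ofReal ((1 - ‖ζ‖ ^ 2) ^ s)) ω *
        (ball 0 1).indicator 1 w := by
  by_cases h : ‖ω‖ ^ 2 + ∑ i, ‖w i‖ ^ 2 < 1
  · have hω : ω ∈ ball (0 : ℂ) 1 := by
      have : 0 ≤ ∑ i, ‖w i‖ ^ 2 := by positivity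
      rw [mem_ball_zero_iff]
      nlinarith [norm_nonneg ω]
    have hw : w ∈ ball (0 : Fin m → ℂ) 1 := by
      rw [mem_ball_zero_iff, pi_norm_lt_iff one_pos]
      intro i
      have : ‖w i‖ ^ 2 ≤ ∑ i, ‖w i‖ ^ 2 := Finset.single_le_sum (f := fun i => ‖w i‖ ^ 2)
        (fun _ _ => by positivity) (Finset.mem_univ i)
      nlinarith [norm_nonneg (w i), sq_nonneg ‖ω‖]
    rw [Set.indicator_of_mem hω, Set.indicator_of_mem hw, Pi.one_apply, mul_one]
    exact lintegral_isotropicCoord_le hs h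
  · have h0 (ζ : ℂ) : isotropicCoord m (ζ, ω, w) ∉ domain (m + 2) :=
      fun hz => h (norm_sq_add_sum_norm_sq_lt_one hz)
    simp [Set.indicator_of_notMem (h0 _)]

end FiberIntegral

theorem lintegral_lt_top_of_comp_continuousLinearEquiv {R E F : Type*} [Semiring R]
    [AddCommGroup E] [Module R E] [TopologicalSpace E] [IsTopologicalAddGroup E]
    [MeasurableSpace E] [BorelSpace E] [AddCommGroup F] [Module R F] [TopologicalSpace F]
    [IsTopologicalAddGroup F] [MeasurableSpace F] [BorelSpace F] [LocallyCompactSpace F]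
    [SecondCountableTopology F] (μ : Measure E) [μ.IsAddHaarMeasure] (ν : Measure F)
    [ν.IsAddHaarMeasure] (L : E ≃L[R] F) {f : F → ℝ≥0∞} (hf : ∫⁻ x, f (L x) ∂μ < ∞) :
    ∫⁻ y, f y ∂ν < ∞ := by
  have hmap : ∫⁻ y, f y ∂(μ.map L) = ∫⁻ x, f (L x) ∂μ :=
    L.toHomeomorph.measurableEmbedding.lintegral_map f
  rw [Measure.isAddLeftInvariant_eq_smul ν (μ.map L), lintegral_smul_measure, hmap]
  exact ENNReal.mul_lt_top ENNReal.coe_lt_top hf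

theorem weighted_univ_lt_top {n : ℕ} (hn : 2 ≤ n) {lam : ℝ} (hlam : (n : ℝ) - 1 < lam) :
    weighted n lam Set.univ < ∞ := by
  obtain ⟨m, rfl⟩ := Nat.exists_eq_add_of_le' hn
  have hs : -1 < lam - (m + 2 : ℕ) := by linarith
  set s := lam - (m + 2 : ℕ)
  set I := ∫⁻ ζ in ball (0 : ℂ) 1, ENNReal.ofReal ((1 - ‖ζ‖ ^ 2) ^ s)
  set f : (Fin (m + 2) → ℂ) → ℝ≥0∞ :=
    (domain (m + 2)).indicator (fun z => ENNReal.ofReal (Delta z ^ s))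
  have hfm : Measurable f :=
    ((continuous_Delta _).measurable.pow_const s).ennreal_ofReal.indicator
      (isOpen_domain _).measurableSet
  have hI : I < ∞ := setLIntegral_ball_one_sub_norm_sq_rpow_lt_top hs
  have : (volume : Measure (ℂ × (Fin m → ℂ))).IsAddHaarMeasure :=
    Measure.prod.instIsAddHaarMeasure volume volume
  have : (volume : Measure (ℂ × ℂ × (Fin m → ℂ))).IsAddHaarMeasure :=
    Measure.prod.instIsAddHaarMeasure volume volume
  rw [weighted, withDensity_apply _ MeasurableSet.univ, Measure.restrict_univ,
    ← lintegral_indicator (isOpen_domain _).measurableSet]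
  refine lintegral_lt_top_of_comp_continuousLinearEquiv volume volume (isotropicCoord m) ?_
  calc ∫⁻ x, f (isotropicCoord m x)
      = ∫⁻ y : ℂ × (Fin m → ℂ), ∫⁻ ζ, f (isotropicCoord m (ζ, y)) :=
        lintegral_prod_symm' _ (hfm.comp (isotropicCoord m).continuous.measurable)
    _ ≤ ∫⁻ y : ℂ × (Fin m → ℂ),
          (ball 0 1).indicator (fun ω => ENNReal.ofReal ((1 - ‖ω‖ ^ 2) ^ s) * I) y.1 *
            (ball 0 1).indicator 1 y.2 :=
        lintegral_mono fun y => lintegral_isotropicCoord_le_mul_indicator hs y.1 y.2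
    _ = I * I * volume (ball (0 : Fin m → ℂ) 1) := by
        rw [Measure.volume_eq_prod, lintegral_prod_mul
          (Measurable.indicator (by fun_prop) measurableSet_ball).aemeasurable
          (measurable_one.indicator measurableSet_ball).aemeasurable,
          lintegral_indicator measurableSet_ball, lintegral_indicator_one measurableSet_ball,
          lintegral_mul_const _ (by fun_prop)]
    _ < ∞ := ENNReal.mul_lt_top (ENNReal.mul_lt_top hI hI) measure_ball_lt_top

/-! ### The domain, its measure and its symmetries -/

section Domain

variable {n : ℕ} {lam : ℝ} {z : Fin n → ℂ}

theorem zero_mem_domain (n : ℕ) : (0 : Fin n → ℂ) ∈ domain n := by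
  simp [domain]

theorem smul_mem_domain (hz : z ∈ domain n) {c : ℂ} (hc : ‖c‖ ≤ 1) : c • z ∈ domain n := by
  obtain ⟨hnorm, hcone⟩ := hz
  have hnorm_smul : ∑ i, ‖(c • z) i‖ ^ 2 = ‖c‖ ^ 2 * ∑ i, ‖z i‖ ^ 2 := by
    simp [mul_pow, Finset.mul_sum]
  have hdot_smul : ‖(c • z) ⬝ᵥ (c • z)‖ ^ 2 = (‖c‖ ^ 2) ^ 2 * ‖z ⬝ᵥ z‖ ^ 2 := by
    rw [smul_dotProduct, dotProduct_smul]
    simp only [smul_eq_mul, norm_mul]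
    ring
  simp only [domain, Set.mem_ofPred_eq, hnorm_smul, hdot_smul]
  have hN : 0 ≤ ∑ i, ‖z i‖ ^ 2 := by positivity
  have hq := norm_dotProduct_self_le z
  have hq0 := norm_nonneg (z ⬝ᵥ z)
  have ht : ‖c‖ ^ 2 ≤ 1 := pow_le_one₀ (norm_nonneg c) hc
  have ht0 : 0 ≤ ‖c‖ ^ 2 := by positivity
  generalize ‖c‖ ^ 2 = t at *
  generalize ∑ i, ‖z i‖ ^ 2 = N at *
  generalize ‖z ⬝ᵥ z‖ = q at *
  have hqN : q ^ 2 ≤ N := by nlinarith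
  refine ⟨by nlinarith, ?_⟩
  nlinarith [mul_nonneg (sub_nonneg.2 ht) (sub_nonneg.2 hqN),
    mul_nonneg (mul_nonneg (sub_nonneg.2 ht) (sub_nonneg.2 ht)) (sq_nonneg q)]

theorem isPreconnected_domain (n : ℕ) : IsPreconnected (domain n) := by
  have hstar : StarConvex ℝ 0 (domain n) := by
    refine starConvex_zero_iff.2 fun z hz t ht0 ht1 => ?_
    simpa using smul_mem_domain hz (c := t) (by simpa [abs_of_nonneg ht0] using ht1)
  exact (hstar.isPathConnected (zero_mem_domain n)).isConnected.isPreconnected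

theorem norm_le_one_of_mem_domain (hz : z ∈ domain n) : ‖z‖ ≤ 1 := by
  rw [pi_norm_le_iff_of_nonneg zero_le_one]
  intro i
  have : ‖z i‖ ^ 2 ≤ ∑ i, ‖z i‖ ^ 2 := Finset.single_le_sum (f := fun i => ‖z i‖ ^ 2)
    (fun _ _ => by positivity) (Finset.mem_univ i)
  nlinarith [hz.1, norm_nonneg (z i)]

theorem volume_domain_ne_top (n : ℕ) : volume (domain n) ≠ ∞ :=
  ne_top_of_le_ne_top (measure_closedBall_lt_top (x := 0) (r := 1)).ne
    (measure_mono fun _ hz => mem_closedBall_zero_iff.2 (norm_le_one_of_mem_domain hz))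

theorem volume_domain_ne_zero (n : ℕ) : volume (domain n) ≠ 0 :=
  ((isOpen_domain n).measure_pos _ ⟨0, zero_mem_domain n⟩).ne'

theorem ae_mem_domain (n : ℕ) (lam : ℝ) : ∀ᵐ z ∂vMeasure n lam, z ∈ domain n :=
  vMeasure_compl n lam

theorem restrict_domain_absolutelyContinuous_weighted (n : ℕ) (lam : ℝ) :
    volume.restrict (domain n) ≪ weighted n lam := by
  refine withDensity_absolutelyContinuous'
    ((continuous_Delta _).measurable.pow_const _).ennreal_ofReal.aemeasurable ?_
  filter_upwards [ae_restrict_mem (isOpen_domain n).measurableSet] with z hz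
  simpa using Real.rpow_pos_of_pos (Delta_pos hz) (lam - n)

theorem weighted_univ_ne_zero (n : ℕ) (lam : ℝ) : weighted n lam Set.univ ≠ 0 := fun h =>
  volume_domain_ne_zero n <| by
    simpa using restrict_domain_absolutelyContinuous_weighted n lam h

theorem isProbabilityMeasure_vMeasure (hn : 2 ≤ n) (hlam : (n : ℝ) - 1 < lam) :
    IsProbabilityMeasure (vMeasure n lam) := by
  refine ⟨?_⟩
  rw [vMeasure, Measure.smul_apply, smul_eq_mul]
  exact ENNReal.inv_mul_cancel (weighted_univ_ne_zero n lam) (weighted_univ_lt_top hn hlam).ne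

theorem restrict_domain_absolutelyContinuous_vMeasure [NeZero (vMeasure n lam)] :
    volume.restrict (domain n) ≪ vMeasure n lam := by
  have hne : (weighted n lam Set.univ)⁻¹ ≠ 0 := fun h =>
    NeZero.ne (vMeasure n lam) (by rw [vMeasure, h, zero_smul])
  exact (restrict_domain_absolutelyContinuous_weighted n lam).trans
    (Measure.absolutelyContinuous_smul hne)

theorem eqOn_domain_of_ae_eq [NeZero (vMeasure n lam)] {f g : (Fin n → ℂ) → ℂ}
    (hf : ContinuousOn f (domain n)) (hg : ContinuousOn g (domain n))
    (h : f =ᵐ[vMeasure n lam] g) : Set.EqOn f g (domain n) :=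
  Measure.eqOn_open_of_ae_eq (restrict_domain_absolutelyContinuous_vMeasure.ae_le h)
    (isOpen_domain n) hf hg

theorem measurePreserving_addHaar_of_preimage_eq {E : Type*} [NormedAddCommGroup E]
    [NormedSpace ℝ E] [FiniteDimensional ℝ E] [MeasurableSpace E] [BorelSpace E]
    (μ : Measure E) [μ.IsAddHaarMeasure] (L : E ≃L[ℝ] E) {s : Set E} (hs0 : μ s ≠ 0)
    (hs : μ s ≠ ∞) (hL : L ⁻¹' s = s) : MeasurePreserving L μ μ := by
  refine ⟨L.continuous.measurable, Measure.ext fun t ht => ?_⟩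
  have hdet : ENNReal.ofReal |LinearMap.det (L.symm : E →ₗ[ℝ] E)| = 1 := by
    have := Measure.addHaar_preimage_continuousLinearEquiv μ L s
    rw [hL] at this
    exact (ENNReal.mul_left_inj hs0 hs).1 (this.symm.trans (one_mul _).symm)
  rw [Measure.map_apply L.continuous.measurable ht,
    Measure.addHaar_preimage_continuousLinearEquiv, hdet, one_mul]

theorem measurePreserving_withDensity {α β : Type*} [MeasurableSpace α]
    [MeasurableSpace β] {μ : Measure α} {ν : Measure β} {g : α → β} (hg : MeasurePreserving g μ ν)
    {f : β → ℝ≥0∞} (hf : Measurable f) :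
    MeasurePreserving g (μ.withDensity (f ∘ g)) (ν.withDensity f) := by
  refine ⟨hg.measurable, Measure.ext fun s hs => ?_⟩
  rw [Measure.map_apply hg.measurable hs, withDensity_apply _ hs,
    withDensity_apply _ (hg.measurable hs), ← hg.setLIntegral_comp_preimage hs hf]
  rfl

theorem measurePreserving_vMeasure (lam : ℝ) (L : (Fin n → ℂ) ≃L[ℝ] (Fin n → ℂ))
    (hsum : ∀ z, ∑ i, ‖L z i‖ ^ 2 = ∑ i, ‖z i‖ ^ 2) (hdot : ∀ z, ‖L z ⬝ᵥ L z‖ = ‖z ⬝ᵥ z‖) :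
    MeasurePreserving L (vMeasure n lam) (vMeasure n lam) := by
  have hD : L ⁻¹' domain n = domain n := by
    ext z
    simp [domain, hsum, hdot]
  have hvol : MeasurePreserving L volume volume :=
    measurePreserving_addHaar_of_preimage_eq volume L (volume_domain_ne_zero n)
      (volume_domain_ne_top n) hD
  have hdens : (fun z => ENNReal.ofReal (Delta z ^ (lam - n))) ∘ L =
      fun z => ENNReal.ofReal (Delta z ^ (lam - n)) := by
    ext z
    simp [Delta, hsum, hdot]
  have hweighted : MeasurePreserving L (weighted n lam) (weighted n lam) := by
    have := measurePreserving_withDensity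
      (hvol.restrict_preimage (isOpen_domain n).measurableSet)
      ((continuous_Delta n).measurable.pow_const (lam - n)).ennreal_ofReal
    rwa [hD, hdens] at this
  exact hweighted.smul_measure _

theorem act_one (z : Fin n → ℂ) : act 1 z = z := by
  simp [act]

theorem act_mul (g h : K n) (z : Fin n → ℂ) : act (g * h) z = act g (act h z) := by
  simp only [act, Prod.fst_mul, Prod.snd_mul, Circle.coe_mul, mulVec_smul, mulVec_mulVec,
    smul_smul]
  congr 2
  exact Matrix.map_mul (f := Complex.ofRealHom)

/-- The action of an element of `SO(n) × SO(2)` as a linear automorphism of `ℂⁿ`. -/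
def actEquiv (g : K n) : (Fin n → ℂ) ≃L[ℂ] (Fin n → ℂ) :=
  LinearEquiv.toContinuousLinearEquiv
    { toFun := act g
      map_add' := fun x y => by simp [act, mulVec_add]
      map_smul' := fun c x => by simp [act, mulVec_smul, smul_comm c]
      invFun := act g⁻¹
      left_inv := fun z => by rw [← act_mul, inv_mul_cancel, act_one]
      right_inv := fun z => by rw [← act_mul, mul_inv_cancel, act_one] }

theorem differentiable_act (g : K n) : Differentiable ℂ (act (n := n) g) :=
  (actEquiv g).differentiable

theorem map_ofReal_transpose_mul_self (A : SO n) :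
    (A.1.map ((↑) : ℝ → ℂ))ᵀ * A.1.map ((↑) : ℝ → ℂ) = 1 := by
  have hA : (A.1ᵀ * A.1).map Complex.ofRealHom = 1 := by
    rw [mul_eq_one_comm.1 (mem_SO_iff.1 A.2).1]
    exact Matrix.map_one _ (map_zero _) (map_one _)
  rwa [Matrix.map_mul] at hA

theorem dotProduct_act (g : K n) (z : Fin n → ℂ) :
    act g z ⬝ᵥ act g z = (g.2 : ℂ) ^ 2 * (z ⬝ᵥ z) := by
  rw [act, smul_dotProduct, dotProduct_smul, dotProduct_mulVec, vecMul_mulVec,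
    map_ofReal_transpose_mul_self, vecMul_one, smul_smul, smul_eq_mul, sq]

theorem norm_dotProduct_act (g : K n) (z : Fin n → ℂ) : ‖act g z ⬝ᵥ act g z‖ = ‖z ⬝ᵥ z‖ := by
  rw [dotProduct_act, norm_mul, norm_pow, Circle.norm_coe, one_pow, one_mul]

theorem ofReal_sum_norm_sq (z : Fin n → ℂ) :
    ((∑ i, ‖z i‖ ^ 2 : ℝ) : ℂ) = star z ⬝ᵥ z := by
  simp [dotProduct, Complex.conj_mul']

theorem sum_norm_sq_act (g : K n) (z : Fin n → ℂ) :
    ∑ i, ‖act g z i‖ ^ 2 = ∑ i, ‖z i‖ ^ 2 := by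
  have hstar : star (act g z) = starRingEnd ℂ (g.2 : ℂ) •
      (g.1.1.map ((↑) : ℝ → ℂ) *ᵥ star z) := by
    ext i
    simp [act, mulVec, dotProduct]
  have h : ((∑ i, ‖act g z i‖ ^ 2 : ℝ) : ℂ) = ((∑ i, ‖z i‖ ^ 2 : ℝ) : ℂ) := by
    rw [ofReal_sum_norm_sq, ofReal_sum_norm_sq, hstar, act, smul_dotProduct, dotProduct_smul,
      dotProduct_mulVec, vecMul_mulVec, map_ofReal_transpose_mul_self, vecMul_one, smul_smul,
      Complex.conj_mul', Circle.norm_coe]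
    simp
  exact_mod_cast h

theorem measurePreserving_act (lam : ℝ) (g : K n) :
    MeasurePreserving (act g) (vMeasure n lam) (vMeasure n lam) :=
  measurePreserving_vMeasure lam ((actEquiv g).restrictScalars ℝ)
    (sum_norm_sq_act g) (norm_dotProduct_act g)

theorem act_mem_domain_iff (g : K n) : act g z ∈ domain n ↔ z ∈ domain n := by
  simp only [domain, Set.mem_ofPred_eq, sum_norm_sq_act, norm_dotProduct_act]

theorem star_mem_invariantSymbols {H : Subgroup (K n)} {a : Lp ℂ ∞ (vMeasure n lam)}
    (ha : a ∈ invariantSymbols n lam H) : star a ∈ invariantSymbols n lam H := by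
  intro h hh
  filter_upwards [ha h hh, Lp.coeFn_star a,
    (measurePreserving_act lam h⁻¹).quasiMeasurePreserving.ae (Lp.coeFn_star a)]
    with z hinv hstar hstar_act
  rw [hstar, hstar_act, Pi.star_apply, Pi.star_apply, hinv]

theorem norm_dotProduct_star_self (z : Fin n → ℂ) : ‖star z ⬝ᵥ star z‖ = ‖z ⬝ᵥ z‖ := by
  rw [star_dotProduct_star, norm_star]

theorem measurePreserving_star (lam : ℝ) :
    MeasurePreserving (star : (Fin n → ℂ) → Fin n → ℂ) (vMeasure n lam) (vMeasure n lam) :=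
  measurePreserving_vMeasure lam (starL' ℝ (A := Fin n → ℂ)) (fun z => by simp)
    norm_dotProduct_star_self

theorem star_mem_domain (hz : z ∈ domain n) : star z ∈ domain n := by
  simpa [domain, norm_dotProduct_star_self] using hz

end Domain

/-! ### The Bergman space as a reproducing kernel Hilbert space -/

section BergmanSpace

variable {n : ℕ} {lam : ℝ} {z : Fin n → ℂ}

theorem exists_differentiableOn_ae_eq (f : BergmanSpace n lam) : ∃ h : (Fin n → ℂ) → ℂ,
    DifferentiableOn ℂ h (domain n) ∧ bergmanIncl n lam f =ᵐ[vMeasure n lam] h :=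
  (show bergman n lam from f).2

/-- The holomorphic representative of an element of the Bergman space. It is extended by zero
outside the domain, so that it depends linearly on the element. -/
def holo (f : BergmanSpace n lam) : (Fin n → ℂ) → ℂ :=
  (domain n).indicator (exists_differentiableOn_ae_eq f).choose

theorem holo_apply_of_notMem (f : BergmanSpace n lam) (hz : z ∉ domain n) : holo f z = 0 :=
  Set.indicator_of_notMem hz _

theorem differentiableOn_holo (f : BergmanSpace n lam) : DifferentiableOn ℂ (holo f) (domain n) :=
  (exists_differentiableOn_ae_eq f).choose_spec.1.congr Set.eqOn_indicator

theorem incl_ae_eq_holo (f : BergmanSpace n lam) :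
    bergmanIncl n lam f =ᵐ[vMeasure n lam] holo f := by
  filter_upwards [(exists_differentiableOn_ae_eq f).choose_spec.2, ae_mem_domain n lam]
    with z hfz hz
  rw [hfz, holo, Set.indicator_of_mem hz]

theorem holo_injective : Function.Injective (holo (n := n) (lam := lam)) := fun f g hfg =>
  (bergmanIncl n lam).injective <| Lp.ext <|
    (incl_ae_eq_holo f).trans (hfg ▸ (incl_ae_eq_holo g).symm)

theorem exists_smul_restrict_le_vMeasure [NeZero (vMeasure n lam)] {s : Set (Fin n → ℂ)}
    (hs : IsCompact s) (hsub : s ⊆ domain n) :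
    ∃ ε : ℝ≥0∞, ε ≠ 0 ∧ ε ≠ ∞ ∧ ε • volume.restrict s ≤ vMeasure n lam := by
  obtain ⟨m, hm, hmle⟩ : ∃ m : ℝ, 0 < m ∧ ∀ z ∈ s, m ≤ Delta z ^ (lam - n) :=
    hs.exists_forall_le' (fun z hz => ((continuous_Delta n).continuousAt.rpow_const
      (Or.inl (Delta_pos (hsub hz)).ne')).continuousWithinAt)
      fun z hz => Real.rpow_pos_of_pos (Delta_pos (hsub hz)) _
  have hweighted : ENNReal.ofReal m • volume.restrict s ≤ weighted n lam := by
    rw [← withDensity_const, weighted]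
    calc (volume.restrict s).withDensity (fun _ => ENNReal.ofReal m)
        ≤ (volume.restrict s).withDensity fun z => ENNReal.ofReal (Delta z ^ (lam - n)) :=
          withDensity_mono <| (ae_restrict_mem hs.measurableSet).mono fun z hz =>
            ENNReal.ofReal_le_ofReal (hmle z hz)
      _ ≤ _ := Measure.le_iff.2 fun t ht => by
          rw [withDensity_apply _ ht, withDensity_apply _ ht]
          exact lintegral_mono' (Measure.restrict_mono le_rfl (Measure.restrict_mono hsub le_rfl))
            le_rfl
  have hc0 : (weighted n lam Set.univ)⁻¹ ≠ 0 := fun h =>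
    NeZero.ne (vMeasure n lam) (by rw [vMeasure, h, zero_smul])
  have hctop : (weighted n lam Set.univ)⁻¹ ≠ ∞ :=
    ENNReal.inv_ne_top.2 (weighted_univ_ne_zero n lam)
  refine ⟨(weighted n lam Set.univ)⁻¹ * ENNReal.ofReal m, mul_ne_zero hc0 (by simpa using hm),
    ENNReal.mul_ne_top hctop ENNReal.ofReal_ne_top, ?_⟩
  rw [mul_smul, vMeasure]
  gcongr

section Coe

variable [NeZero (vMeasure n lam)]

theorem holo_eq_of_ae_eq {f : BergmanSpace n lam} {h : (Fin n → ℂ) → ℂ}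
    (hh : ContinuousOn h (domain n)) (h0 : ∀ z ∉ domain n, h z = 0)
    (hf : bergmanIncl n lam f =ᵐ[vMeasure n lam] h) : holo f = h := by
  ext z
  by_cases hz : z ∈ domain n
  · exact eqOn_domain_of_ae_eq (differentiableOn_holo f).continuousOn hh
      ((incl_ae_eq_holo f).symm.trans hf) hz
  · rw [holo_apply_of_notMem f hz, h0 z hz]

theorem holo_add (f g : BergmanSpace n lam) : holo (f + g) = holo f + holo g := by
  refine holo_eq_of_ae_eq
    ((differentiableOn_holo f).continuousOn.add (differentiableOn_holo g).continuousOn)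
    (fun z hz => by simp [holo_apply_of_notMem _ hz]) ?_
  rw [map_add]
  exact (Lp.coeFn_add _ _).trans ((incl_ae_eq_holo f).add (incl_ae_eq_holo g))

theorem holo_smul (c : ℂ) (f : BergmanSpace n lam) : holo (c • f) = c • holo f := by
  refine holo_eq_of_ae_eq ((differentiableOn_holo f).continuousOn.const_smul c)
    (fun z hz => by simp [holo_apply_of_notMem _ hz]) ?_
  rw [map_smul]
  exact (Lp.coeFn_smul _ _).trans ((incl_ae_eq_holo f).const_smul c)

theorem exists_norm_holo_le (z : Fin n → ℂ) :
    ∃ C : ℝ, ∀ f : BergmanSpace n lam, ‖holo f z‖ ≤ C * ‖f‖ := by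
  by_cases hz : z ∈ domain n
  · obtain ⟨R, hR, hsub⟩ := nhds_basis_closedBall.mem_iff.1 ((isOpen_domain n).mem_nhds hz)
    obtain ⟨ε, hε, hε', hle⟩ :=
      exists_smul_restrict_le_vMeasure (lam := lam) (isCompact_closedBall z R) hsub
    obtain ⟨C, -, hC⟩ := norm_le_of_aeEq (isOpen_domain n) hR hε hε' hsub hle
    refine ⟨C, fun f => ?_⟩
    simpa only [LinearIsometry.norm_map] using hC (holo f) (bergmanIncl n lam f)
      (differentiableOn_holo f) (incl_ae_eq_holo f) z (mem_closedBall_self (by positivity))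
  · exact ⟨0, fun f => by simp [holo_apply_of_notMem f hz]⟩

/-- The Bergman space consists of functions, `f z` being the value at `z` of the holomorphic
representative `holo f`; this is what makes the reproducing kernel available. -/
instance : RKHS ℂ (BergmanSpace n lam) (Fin n → ℂ) ℂ where
  coeCLM :=
    { toFun := holo
      map_add' := holo_add
      map_smul' := holo_smul
      cont := continuous_pi fun z => by
        obtain ⟨C, hC⟩ := exists_norm_holo_le (lam := lam) z
        let ev : BergmanSpace n lam →ₗ[ℂ] ℂ :=
          { toFun := fun f => holo f z
            map_add' := fun f g => congrFun (holo_add f g) z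
            map_smul' := fun c f => congrFun (holo_smul c f) z }
        exact (ev.mkContinuous C hC).continuous }
  coeCLM_injective := holo_injective

theorem apply_of_notMem (f : BergmanSpace n lam) (hz : z ∉ domain n) : f z = 0 :=
  holo_apply_of_notMem f hz

theorem differentiableOn_coe (f : BergmanSpace n lam) : DifferentiableOn ℂ f (domain n) :=
  differentiableOn_holo f

theorem incl_ae_eq_coe (f : BergmanSpace n lam) :
    bergmanIncl n lam f =ᵐ[vMeasure n lam] f :=
  incl_ae_eq_holo f

theorem memLp_coe (f : BergmanSpace n lam) : MemLp f 2 (vMeasure n lam) :=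
  (Lp.memLp (bergmanIncl n lam f)).ae_eq (incl_ae_eq_coe f)

theorem eq_zero_of_eventuallyEq_zero {f : BergmanSpace n lam} (hz : z ∈ domain n)
    (hf : f =ᶠ[nhds z] 0) : f = 0 := by
  refine RKHS.ext fun w => ?_
  by_cases hw : w ∈ domain n
  · rw [RKHS.coe_zero]
    exact eqOn_zero_of_isPreconnected_of_eventuallyEq_zero (isOpen_domain n)
      (isPreconnected_domain n) (differentiableOn_coe f) hz hf hw
  · simpa using apply_of_notMem f hw

end Coe

/-- The element of the Bergman space represented by a square integrable holomorphic function. -/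
def mkBergman (h : (Fin n → ℂ) → ℂ) (hd : DifferentiableOn ℂ h (domain n))
    (hL : MemLp h 2 (vMeasure n lam)) : BergmanSpace n lam :=
  (⟨hL.toLp h, h, hd, hL.coeFn_toLp⟩ : bergman n lam)

theorem incl_mkBergman_ae_eq {h : (Fin n → ℂ) → ℂ} (hd : DifferentiableOn ℂ h (domain n))
    (hL : MemLp h 2 (vMeasure n lam)) :
    bergmanIncl n lam (mkBergman h hd hL) =ᵐ[vMeasure n lam] h :=
  hL.coeFn_toLp

variable [NeZero (vMeasure n lam)]

theorem mkBergman_apply {h : (Fin n → ℂ) → ℂ} (hd : DifferentiableOn ℂ h (domain n))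
    (hL : MemLp h 2 (vMeasure n lam)) (hz : z ∈ domain n) : mkBergman h hd hL z = h z :=
  eqOn_domain_of_ae_eq (differentiableOn_coe _).continuousOn hd.continuousOn
    ((incl_ae_eq_coe _).symm.trans (incl_mkBergman_ae_eq hd hL)) hz

theorem coe_mkBergman {h : (Fin n → ℂ) → ℂ} (hd : DifferentiableOn ℂ h (domain n))
    (hL : MemLp h 2 (vMeasure n lam)) (h0 : ∀ z ∉ domain n, h z = 0) :
    ⇑(mkBergman h hd hL) = h :=
  holo_eq_of_ae_eq hd.continuousOn h0 (incl_mkBergman_ae_eq hd hL)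

theorem inner_eq_integral (f g : BergmanSpace n lam) :
    ⟪f, g⟫_ℂ = ∫ z, g z * star (f z) ∂vMeasure n lam := by
  rw [← (bergmanIncl n lam).inner_map_map, L2.inner_def]
  refine integral_congr_ae ?_
  filter_upwards [incl_ae_eq_coe f, incl_ae_eq_coe g] with z hf hg
  rw [hf, hg]
  rfl

theorem inner_toeplitz (a : Lp ℂ ∞ (vMeasure n lam)) (f g : BergmanSpace n lam) :
    ⟪g, toeplitz n lam a f⟫_ℂ = ∫ z, a z * f z * star (g z) ∂vMeasure n lam := by
  have : CompleteSpace (bergman n lam) := (isClosed_bergman n lam).completeSpace_coe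
  have hproj : ⟪g, toeplitz n lam a f⟫_ℂ =
      ⟪bergmanIncl n lam g, mulOp n lam a (bergmanIncl n lam f)⟫_ℂ :=
    Submodule.inner_orthogonalProjectionOnto_eq_of_mem_left (K := bergman n lam)
      (show bergman n lam from g) (mulOp n lam a (bergmanIncl n lam f))
  have hmul : mulOp n lam a (bergmanIncl n lam f) =ᵐ[vMeasure n lam]
      fun z => a z * bergmanIncl n lam f z :=
    (ContinuousLinearMap.mul ℂ ℂ).coeFn_holder (r := 2) a _
  rw [hproj, L2.inner_def]
  refine integral_congr_ae ?_
  filter_upwards [incl_ae_eq_coe f, incl_ae_eq_coe g, hmul] with z hf hg hz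
  rw [hz, hf, hg]
  rfl

/-! ### Adjoints of Toeplitz operators -/

theorem star_toeplitz (a : Lp ℂ ∞ (vMeasure n lam)) :
    star (toeplitz n lam a) = toeplitz n lam (star a) := by
  rw [ContinuousLinearMap.star_eq_adjoint, eq_comm, ContinuousLinearMap.eq_adjoint_iff]
  intro f g
  rw [inner_toeplitz, ← inner_conj_symm, inner_toeplitz, ← integral_conj]
  refine integral_congr_ae ?_
  filter_upwards [Lp.coeFn_star a] with z hz
  simp only [hz, Pi.star_apply, map_mul, RCLike.star_def, RCLike.conj_conj]
  ring

theorem star_mem_toeplitzAlgebra {S : Set (Lp ℂ ∞ (vMeasure n lam))} (hS : ∀ a ∈ S, star a ∈ S)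
    {T : BergmanSpace n lam →L[ℂ] BergmanSpace n lam} (hT : T ∈ toeplitzAlgebra n lam S) :
    star T ∈ toeplitzAlgebra n lam S := by
  have hgen : star (toeplitz n lam '' S) ⊆ toeplitz n lam '' S := by
    rintro T ⟨a, ha, hT⟩
    exact ⟨star a, hS a ha, by rw [← star_toeplitz, hT, star_star]⟩
  refine map_mem_closure continuous_star hT fun T hT => Algebra.adjoin_mono hgen ?_
  rwa [← Subalgebra.star_adjoin_comm, Subalgebra.mem_star_iff, star_star]

theorem isCStarSubalgebra_toeplitzAlgebra (H : Subgroup (K n)) :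
    IsCStarSubalgebra (toeplitzAlgebra n lam (invariantSymbols n lam H)) :=
  ⟨Subalgebra.isClosed_topologicalClosure _,
    fun _ => star_mem_toeplitzAlgebra fun _ => star_mem_invariantSymbols⟩

end BergmanSpace

/-! ### Rotations and complex conjugation on the Bergman space -/

section Symmetries

variable {n : ℕ} {lam : ℝ} {z : Fin n → ℂ} [NeZero (vMeasure n lam)]

theorem norm_eq_eLpNorm (f : BergmanSpace n lam) :
    ‖f‖ = (eLpNorm f 2 (vMeasure n lam)).toReal := by
  rw [← (bergmanIncl n lam).norm_map, Lp.norm_def, eLpNorm_congr_ae (incl_ae_eq_coe f)]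

/-- The function `f ∘ g⁻¹`, as an element of the Bergman space. -/
def rotFun (g : K n) (f : BergmanSpace n lam) : BergmanSpace n lam :=
  mkBergman (f ∘ act g⁻¹)
    ((differentiableOn_coe f).comp (differentiable_act _).differentiableOn
      fun _ => (act_mem_domain_iff _).2)
    ((memLp_coe f).comp_measurePreserving (measurePreserving_act lam g⁻¹))

theorem coe_rotFun (g : K n) (f : BergmanSpace n lam) : ⇑(rotFun g f) = f ∘ act g⁻¹ :=
  coe_mkBergman _ _ fun _ hz => apply_of_notMem f ((act_mem_domain_iff _).not.2 hz)

/-- The isometric action `f ↦ f ∘ g⁻¹` of `SO(n) × SO(2)` on the Bergman space. -/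
def rotOp (lam : ℝ) [NeZero (vMeasure n lam)] (g : K n) :
    BergmanSpace n lam →ₗᵢ[ℂ] BergmanSpace n lam where
  toFun := rotFun g
  map_add' f h := RKHS.ext fun z => by simp [coe_rotFun]
  map_smul' c f := RKHS.ext fun z => by simp [coe_rotFun]
  norm_map' f := by
    change ‖rotFun g f‖ = ‖f‖
    rw [norm_eq_eLpNorm, norm_eq_eLpNorm, coe_rotFun, eLpNorm_comp_measurePreserving
      (memLp_coe f).aestronglyMeasurable (measurePreserving_act lam g⁻¹)]

theorem rotOp_apply (g : K n) (f : BergmanSpace n lam) (z : Fin n → ℂ) :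
    rotOp lam g f z = f (act g⁻¹ z) :=
  congrFun (coe_rotFun g f) z

theorem rotOp_rotOp_inv (g : K n) (f : BergmanSpace n lam) :
    rotOp lam g (rotOp lam g⁻¹ f) = f :=
  RKHS.ext fun z => by
    rw [rotOp_apply, rotOp_apply, ← act_mul, inv_inv, mul_inv_cancel, act_one]

theorem toeplitz_rotOp {H : Subgroup (K n)} {a : Lp ℂ ∞ (vMeasure n lam)}
    (ha : a ∈ invariantSymbols n lam H) {g : K n} (hg : g ∈ H) (f : BergmanSpace n lam) :
    toeplitz n lam a (rotOp lam g f) = rotOp lam g (toeplitz n lam a f) := by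
  refine ext_inner_left ℂ fun h => ?_
  obtain ⟨h, rfl⟩ : ∃ h', rotOp lam g h' = h := ⟨_, rotOp_rotOp_inv g h⟩
  rw [(rotOp lam g).inner_map_map, inner_toeplitz, inner_toeplitz,
    ← (measurePreserving_act lam g⁻¹).integral_comp
      (actEquiv g⁻¹).toHomeomorph.measurableEmbedding fun z => a z * f z * star (h z)]
  refine integral_congr_ae ?_
  filter_upwards [ha g hg] with z hz
  rw [rotOp_apply, rotOp_apply, ← hz]

/-- The function `z ↦ conj (f (conj z))`, as an element of the Bergman space. -/
def conjFun (f : BergmanSpace n lam) : BergmanSpace n lam :=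
  mkBergman (fun z => star (f (star z)))
    (fun z hz => by
      have h := ((differentiableOn_coe f).differentiableAt
        ((isOpen_domain n).mem_nhds (star_mem_domain hz))).star_star
      rw [star_star] at h
      exact h.differentiableWithinAt)
    ((memLp_coe f).comp_measurePreserving (measurePreserving_star lam)).star

theorem conjFun_apply (f : BergmanSpace n lam) (z : Fin n → ℂ) :
    conjFun f z = star (f (star z)) := by
  refine congrFun (coe_mkBergman _ _ fun z hz => ?_) z
  rw [apply_of_notMem f fun h => hz (by simpa using star_mem_domain h), star_zero]

theorem inner_conjFun_conjFun (f g : BergmanSpace n lam) :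
    ⟪conjFun f, conjFun g⟫_ℂ = ⟪g, f⟫_ℂ := by
  rw [inner_eq_integral, inner_eq_integral,
    ← (measurePreserving_star lam).integral_comp
      (starL' ℝ (A := Fin n → ℂ)).toHomeomorph.measurableEmbedding fun z => f z * star (g z)]
  simp only [conjFun_apply, star_star, mul_comm]

/-- The antilinear isometry `f ↦ conj ∘ f ∘ conj` of the Bergman space. -/
def conjOp (n : ℕ) (lam : ℝ) [NeZero (vMeasure n lam)] :
    BergmanSpace n lam →ₛₗᵢ[starRingEnd ℂ] BergmanSpace n lam where
  toFun := conjFun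
  map_add' f g := RKHS.ext fun z => by simp [conjFun_apply]
  map_smul' c f := RKHS.ext fun z => by simp [conjFun_apply]
  norm_map' f := by
    change ‖conjFun f‖ = ‖f‖
    rw [@norm_eq_sqrt_re_inner ℂ, @norm_eq_sqrt_re_inner ℂ _ _ _ _ f, inner_conjFun_conjFun]

theorem conjOp_apply (f : BergmanSpace n lam) (z : Fin n → ℂ) :
    conjOp n lam f z = star (f (star z)) :=
  conjFun_apply f z

theorem conjOp_conjOp (f : BergmanSpace n lam) : conjOp n lam (conjOp n lam f) = f :=
  RKHS.ext fun z => by rw [conjOp_apply, conjOp_apply, star_star, star_star]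

theorem inner_conjOp_left (f g : BergmanSpace n lam) :
    ⟪conjOp n lam f, g⟫_ℂ = ⟪conjOp n lam g, f⟫_ℂ := by
  conv_lhs => rw [← conjOp_conjOp g]
  exact inner_conjFun_conjFun f (conjOp n lam g)

/-! ### The reproducing kernel -/

/-- The reproducing kernel `k_z` of the Bergman space at `z`: the element representing the
evaluation at `z`. -/
def kernel (n : ℕ) (lam : ℝ) [NeZero (vMeasure n lam)] (z : Fin n → ℂ) : BergmanSpace n lam :=
  RKHS.kerFun (BergmanSpace n lam) z (1 : ℂ)

theorem inner_kernel_left (z : Fin n → ℂ) (f : BergmanSpace n lam) :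
    ⟪kernel n lam z, f⟫_ℂ = f z := by
  simp [kernel]

theorem inner_kernel_right (z : Fin n → ℂ) (f : BergmanSpace n lam) :
    ⟪f, kernel n lam z⟫_ℂ = star (f z) := by
  simp [kernel]

theorem kernel_star (z : Fin n → ℂ) : kernel n lam (star z) = conjOp n lam (kernel n lam z) := by
  refine ext_inner_right ℂ fun f => ?_
  rw [inner_kernel_left, inner_conjOp_left, inner_kernel_right, conjOp_apply, star_star]

theorem rotOp_kernel (g : K n) (z : Fin n → ℂ) :
    rotOp lam g (kernel n lam z) = kernel n lam (act g z) := by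
  refine ext_inner_right ℂ fun f => ?_
  obtain ⟨f, rfl⟩ : ∃ f', rotOp lam g f' = f := ⟨_, rotOp_rotOp_inv g f⟩
  rw [(rotOp lam g).inner_map_map, inner_kernel_left, inner_kernel_left, rotOp_apply, ← act_mul,
    inv_mul_cancel, act_one]

theorem exists_forall_apply_kernel_star_eq (ℓ : StrongDual ℂ (BergmanSpace n lam)) :
    ∃ f : BergmanSpace n lam, ∀ z, ℓ (kernel n lam (star z)) = f z := by
  obtain ⟨f, rfl⟩ := (InnerProductSpace.toDual ℂ (BergmanSpace n lam)).surjective ℓ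
  refine ⟨conjOp n lam f, fun z => ?_⟩
  rw [InnerProductSpace.toDual_apply_apply, inner_kernel_right, conjOp_apply]

theorem differentiableOn_kernel_star (a b : Fin n → ℂ) :
    DifferentiableOn ℂ (fun s : ℂ => kernel n lam (star (a + s • b)))
      ((fun s : ℂ => a + s • b) ⁻¹' domain n) := by
  have hline : Differentiable ℂ fun s : ℂ => a + s • b := by fun_prop
  refine differentiableOn_of_weakly_differentiableOn
    ((isOpen_domain n).preimage hline.continuous) fun ℓ => ?_
  obtain ⟨f, hf⟩ := exists_forall_apply_kernel_star_eq ℓ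
  simp only [hf]
  exact (differentiableOn_coe f).comp hline.differentiableOn fun s hs => hs

theorem continuousOn_kernel : ContinuousOn (kernel n lam) (domain n) := by
  intro z hz
  have hz' := star_mem_domain hz
  obtain ⟨r, hr, hsub⟩ := nhds_basis_closedBall.mem_iff.1 ((isOpen_domain n).mem_nhds hz')
  have hstar : ContinuousAt (fun w => kernel n lam (star w)) (star z) :=
    continuousAt_of_weakly_differentiableOn hr fun ℓ => by
      obtain ⟨f, hf⟩ := exists_forall_apply_kernel_star_eq ℓ
      simpa only [hf] using (differentiableOn_coe f).mono hsub
  simpa only [Function.comp_def, star_star] using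
    (hstar.comp continuous_star.continuousAt).continuousWithinAt

theorem dense_span_kernel {s : Set (Fin n → ℂ)} (hz : z ∈ domain n) (hs : s ∈ nhds z) :
    Dense (Submodule.span ℂ (kernel n lam '' s) : Set (BergmanSpace n lam)) := by
  rw [Submodule.dense_iff_topologicalClosure_eq_top, Submodule.topologicalClosure_eq_top_iff,
    Submodule.eq_bot_iff]
  intro f hf
  refine eq_zero_of_eventuallyEq_zero hz ?_
  filter_upwards [hs] with w hw
  rw [← inner_kernel_left]
  exact (Submodule.mem_orthogonal _ f).1 hf _ (Submodule.subset_span ⟨w, hw, rfl⟩)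

end Symmetries

/-! ### Conjugates in the orbits of `SO(n) × SO(2)` -/

section Commutativity

variable {n : ℕ} {lam : ℝ} {z : Fin n → ℂ}

/-- The reflection in the hyperplane orthogonal to `v`. -/
def reflMatrix (v : Fin n → ℝ) : Matrix (Fin n) (Fin n) ℝ :=
  1 - (2 / (v ⬝ᵥ v)) • vecMulVec v v

theorem reflMatrix_mulVec (v x : Fin n → ℝ) :
    reflMatrix v *ᵥ x = x - (2 / (v ⬝ᵥ v) * (v ⬝ᵥ x)) • v := by
  rw [reflMatrix, sub_mulVec, one_mulVec, smul_mulVec, vecMulVec_mulVec,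
    op_smul_eq_smul, smul_smul]

theorem reflMatrix_mul_transpose {v : Fin n → ℝ} (hv : v ⬝ᵥ v ≠ 0) :
    reflMatrix v * (reflMatrix v)ᵀ = 1 := by
  have h : vecMulVec v v * vecMulVec v v = (v ⬝ᵥ v) • vecMulVec v v := by
    rw [vecMulVec_mul_vecMulVec, vecMulVec_smul]
  simp only [reflMatrix, transpose_sub, transpose_one, transpose_smul, transpose_vecMulVec]
  rw [sub_mul, mul_sub, mul_sub, one_mul, mul_one, one_mul, smul_mul_smul_comm, h, smul_smul,
    ← sub_add, sub_sub, ← add_smul, sub_add, ← sub_smul]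
  have : 2 / (v ⬝ᵥ v) + 2 / (v ⬝ᵥ v) - 2 / (v ⬝ᵥ v) * (2 / (v ⬝ᵥ v)) * (v ⬝ᵥ v) = 0 := by
    field_simp
    ring
  rw [this, zero_smul, sub_zero]

theorem det_reflMatrix {v : Fin n → ℝ} (hv : v ⬝ᵥ v ≠ 0) : (reflMatrix v).det = -1 := by
  have h : reflMatrix v = 1 + replicateCol Unit (-(2 / (v ⬝ᵥ v)) • v) * replicateRow Unit v := by
    rw [reflMatrix, ← vecMulVec_eq, smul_vecMulVec, neg_smul, sub_eq_add_neg]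
  rw [h, det_one_add_replicateCol_mul_replicateRow, dotProduct_smul, smul_eq_mul]
  field_simp
  ring

theorem exists_dotProduct_eq_zero (hn : 3 ≤ n) (x y : Fin n → ℝ) :
    ∃ e : Fin n → ℝ, e ⬝ᵥ e ≠ 0 ∧ e ⬝ᵥ x = 0 ∧ e ⬝ᵥ y = 0 := by
  set f : (Fin n → ℝ) →ₗ[ℝ] (Fin 2 → ℝ) := (Matrix.of ![x, y]).mulVecLin with hf
  have hk : LinearMap.ker f ≠ ⊥ := by
    apply LinearMap.ker_ne_bot_of_finrank_lt
    simp
    omega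
  obtain ⟨e, he, he0⟩ := (Submodule.ne_bot_iff _).1 hk
  rw [LinearMap.mem_ker] at he
  refine ⟨e, by simpa using he0, ?_, ?_⟩
  · have := congrFun he 0
    rw [dotProduct_comm]
    simpa [hf, mulVec] using this
  · have := congrFun he 1
    rw [dotProduct_comm]
    simpa [hf, mulVec] using this

theorem exists_SO_fix_neg (hn : 3 ≤ n) {x y : Fin n → ℝ} (hxy : y ⬝ᵥ x = 0) :
    ∃ A : SO n, A.1 *ᵥ x = x ∧ A.1 *ᵥ y = -y := by
  by_cases hy : y ⬝ᵥ y = 0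
  · refine ⟨1, by simp, ?_⟩
    have : y = 0 := by simpa using hy
    simp [this]
  obtain ⟨e, he, hex, hey⟩ := exists_dotProduct_eq_zero hn x y
  refine ⟨⟨reflMatrix e * reflMatrix y, mem_SO_iff.2 ⟨?_, ?_⟩⟩, ?_, ?_⟩
  · rw [transpose_mul, mul_assoc, ← mul_assoc (reflMatrix y), reflMatrix_mul_transpose hy, one_mul,
      reflMatrix_mul_transpose he]
  · rw [det_mul, det_reflMatrix he, det_reflMatrix hy]
    norm_num
  · change (reflMatrix e * reflMatrix y) *ᵥ x = x
    rw [← mulVec_mulVec, reflMatrix_mulVec y, hxy, mul_zero, zero_smul, sub_zero,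
      reflMatrix_mulVec, hex, mul_zero, zero_smul, sub_zero]
  · change (reflMatrix e * reflMatrix y) *ᵥ y = -y
    have h1 : reflMatrix y *ᵥ y = -y := by
      rw [reflMatrix_mulVec, div_mul_cancel₀ _ hy, two_smul]
      abel
    rw [← mulVec_mulVec, h1, mulVec_neg, reflMatrix_mulVec, hey, mul_zero, zero_smul, sub_zero]

theorem exists_circle_sq_mul (q : ℂ) : ∃ t : Circle, (t : ℂ) ^ 2 * q = ‖q‖ := by
  refine ⟨Circle.exp (-(q.arg / 2)), ?_⟩
  have hq := Complex.norm_mul_exp_arg_mul_I q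
  have h0 : ((2 : ℕ) : ℂ) * (((-(q.arg / 2) : ℝ) : ℂ) * Complex.I) + q.arg * Complex.I = 0 := by
    push_cast
    ring
  calc (Circle.exp (-(q.arg / 2)) : ℂ) ^ 2 * q
      = (Circle.exp (-(q.arg / 2)) : ℂ) ^ 2 * (‖q‖ * Complex.exp (q.arg * Complex.I)) := by
        rw [hq]
    _ = (‖q‖ : ℂ) := by
        rw [Circle.coe_exp, mul_left_comm, ← Complex.exp_nat_mul, ← Complex.exp_add, h0,
          Complex.exp_zero, mul_one]

theorem exists_SO_mulVec_eq_star (hn : 3 ≤ n) {w : Fin n → ℂ} (hw : (w ⬝ᵥ w).im = 0) :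
    ∃ A : SO n, A.1.map ((↑) : ℝ → ℂ) *ᵥ w = star w := by
  set x : Fin n → ℝ := fun i => (w i).re
  set y : Fin n → ℝ := fun i => (w i).im
  have hxy : y ⬝ᵥ x = 0 := by
    have h : (w ⬝ᵥ w).im = 2 * (y ⬝ᵥ x) := by
      simp only [dotProduct, Complex.im_sum, Complex.mul_im, Finset.mul_sum, x, y]
      exact Finset.sum_congr rfl fun i _ => by ring
    linarith
  obtain ⟨A, hAx, hAy⟩ := exists_SO_fix_neg hn hxy
  refine ⟨A, funext fun i => Complex.ext ?_ ?_⟩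
  · simpa [mulVec, dotProduct, x] using congrFun hAx i
  · simpa [mulVec, dotProduct, y] using congrFun hAy i

theorem exists_act_eq_star (hn : 3 ≤ n) (z : Fin n → ℂ) : ∃ g : K n, act g z = star z := by
  obtain ⟨t, ht⟩ := exists_circle_sq_mul (z ⬝ᵥ z)
  have hreal : (((t : ℂ) • z) ⬝ᵥ ((t : ℂ) • z)).im = 0 := by
    rw [smul_dotProduct, dotProduct_smul, smul_smul, smul_eq_mul, ← sq, ht, Complex.ofReal_im]
  obtain ⟨A, hA⟩ := exists_SO_mulVec_eq_star hn hreal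
  have hunit : (t : ℂ) * star (t : ℂ) = 1 := by
    rw [RCLike.star_def, Complex.mul_conj', Circle.norm_coe, Complex.ofReal_one, one_pow]
  refine ⟨(A, t * t), ?_⟩
  calc act (A, t * t) z
      = (t : ℂ) • (A.1.map ((↑) : ℝ → ℂ) *ᵥ ((t : ℂ) • z)) := by
        simp only [act, mulVec_smul, smul_smul, Circle.coe_mul]
    _ = star z := by rw [hA, star_smul, smul_smul, hunit, one_smul]

/-! ### Operators commuting with `SO(n) × SO(2)` -/

variable [NeZero (vMeasure n lam)] {S T : BergmanSpace n lam →L[ℂ] BergmanSpace n lam}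

theorem inner_kernel_star_apply_kernel_star (hn : 3 ≤ n)
    (hS : ∀ g f, S (rotOp lam g f) = rotOp lam g (S f)) (z : Fin n → ℂ) :
    ⟪kernel n lam (star z), S (kernel n lam (star z))⟫_ℂ =
      ⟪kernel n lam z, S (kernel n lam z)⟫_ℂ := by
  obtain ⟨g, hg⟩ := exists_act_eq_star hn z
  rw [← hg, ← rotOp_kernel, hS, (rotOp lam g).inner_map_map]

/-- The complex bilinear form `(f, g) ↦ ⟪conj f, g⟫` on the Bergman space. -/
def conjForm (n : ℕ) (lam : ℝ) [NeZero (vMeasure n lam)] :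
    BergmanSpace n lam →L[ℂ] BergmanSpace n lam →L[ℂ] ℂ :=
  (innerSL ℂ).comp (conjOp n lam).toContinuousLinearMap

theorem conjForm_apply (f g : BergmanSpace n lam) : conjForm n lam f g = ⟪conjOp n lam f, g⟫_ℂ :=
  rfl

theorem conjForm_comm (f g : BergmanSpace n lam) : conjForm n lam f g = conjForm n lam g f :=
  inner_conjOp_left f g

/- The difference of the two sides is holomorphic in `star u` and `star w` and vanishes for
`u = star w`. -/
theorem exists_conjForm_kernel_comm (hn : 3 ≤ n)
    (hS : ∀ g f, S (rotOp lam g f) = rotOp lam g (S f)) :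
    ∃ R > 0, ∀ u ∈ ball (0 : Fin n → ℂ) R, ∀ w ∈ ball (0 : Fin n → ℂ) R,
      conjForm n lam (kernel n lam u) (S (kernel n lam w)) =
        conjForm n lam (kernel n lam w) (S (kernel n lam u)) := by
  obtain ⟨R, hR, hball⟩ := Metric.isOpen_iff.1 (isOpen_domain n) 0 (zero_mem_domain n)
  have hkernel : ∀ a b : Fin n → ℂ, DifferentiableOn ℂ
      (fun s : ℂ => kernel n lam (star (a + s • b))) ((fun s : ℂ => a + s • b) ⁻¹' ball 0 R) :=
    fun a b => (differentiableOn_kernel_star a b).mono (Set.preimage_mono hball)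
  have hform : ∀ {κ₁ κ₂ : ℂ → BergmanSpace n lam} {U : Set ℂ}, DifferentiableOn ℂ κ₁ U →
      DifferentiableOn ℂ κ₂ U → DifferentiableOn ℂ (fun s => conjForm n lam (κ₁ s) (S (κ₂ s))) U :=
    fun h₁ h₂ => ((conjForm n lam).differentiable.comp_differentiableOn h₁).clm_apply
      (S.differentiable.comp_differentiableOn h₂)
  set Φ : (Fin n → ℂ) → (Fin n → ℂ) → ℂ := fun z w =>
    conjForm n lam (kernel n lam (star z)) (S (kernel n lam (star w))) -
      conjForm n lam (kernel n lam (star w)) (S (kernel n lam (star z)))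
  have hΦ : ∀ z ∈ ball (0 : Fin n → ℂ) R, ∀ w ∈ ball (0 : Fin n → ℂ) R, Φ z w = 0 := by
    refine fun z hz w hw => eq_zero_of_forall_apply_star_eq_zero (fun a b c d => ?_)
      (fun z _ => ?_) hz hw
    · have hz := (hkernel a b).mono
        (Set.inter_subset_left (t := (fun s => c + s • d) ⁻¹' ball 0 R))
      have hw := (hkernel c d).mono
        (Set.inter_subset_right (s := (fun s => a + s • b) ⁻¹' ball 0 R))
      exact (hform hz hw).sub (hform hw hz)
    · simp only [Φ, conjForm_apply, ← kernel_star, star_star]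
      rw [inner_kernel_star_apply_kernel_star hn hS, sub_self]
  refine ⟨R, hR, fun u hu w hw => ?_⟩
  simpa only [Φ, star_star, sub_eq_zero] using
    hΦ (star u) (by simpa using hu) (star w) (by simpa using hw)

theorem conjForm_apply_comm (hn : 3 ≤ n)
    (hS : ∀ g f, S (rotOp lam g f) = rotOp lam g (S f)) (f g : BergmanSpace n lam) :
    conjForm n lam f (S g) = conjForm n lam g (S f) := by
  obtain ⟨R, hR, hker⟩ := exists_conjForm_kernel_comm hn hS
  have hdense := dense_span_kernel (lam := lam) (zero_mem_domain n) (ball_mem_nhds 0 hR)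
  have hleft : ∀ w ∈ ball (0 : Fin n → ℂ) R, (conjForm n lam).flip (S (kernel n lam w)) =
      (conjForm n lam (kernel n lam w)).comp S := by
    rintro w hw
    refine ContinuousLinearMap.ext_on hdense ?_
    rintro _ ⟨u, hu, rfl⟩
    exact hker u hu w hw
  have hright : (conjForm n lam f).comp S = (conjForm n lam).flip (S f) := by
    refine ContinuousLinearMap.ext_on hdense ?_
    rintro _ ⟨w, hw, rfl⟩
    exact DFunLike.congr_fun (hleft w hw) f
  exact DFunLike.congr_fun hright g

theorem mul_comm_of_commute_rotOp (hn : 3 ≤ n)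
    (hS : ∀ g f, S (rotOp lam g f) = rotOp lam g (S f))
    (hT : ∀ g f, T (rotOp lam g f) = rotOp lam g (T f)) : S * T = T * S := by
  have hST : ∀ g f, (S * T) (rotOp lam g f) = rotOp lam g ((S * T) f) := fun g f => by
    rw [mul_apply_eq_comp, hT, hS, mul_apply_eq_comp]
  ext1 f
  refine ext_inner_left ℂ fun h => ?_
  obtain ⟨h, rfl⟩ : ∃ h', conjOp n lam h' = h := ⟨_, conjOp_conjOp h⟩
  calc conjForm n lam h (S (T f))
      = conjForm n lam f (S (T h)) := conjForm_apply_comm hn hST h f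
    _ = conjForm n lam (T h) (S f) := conjForm_apply_comm hn hS f (T h)
    _ = conjForm n lam (S f) (T h) := conjForm_comm _ _
    _ = conjForm n lam h (T (S f)) := conjForm_apply_comm hn hT (S f) h

theorem apply_rotOp_of_mem_toeplitzAlgebra {H : Subgroup (K n)}
    (hT : T ∈ toeplitzAlgebra n lam (invariantSymbols n lam H)) {g : K n} (hg : g ∈ H)
    (f : BergmanSpace n lam) : T (rotOp lam g f) = rotOp lam g (T f) := by
  set U : BergmanSpace n lam →L[ℂ] BergmanSpace n lam := (rotOp lam g).toContinuousLinearMap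
  have hle : toeplitzAlgebra n lam (invariantSymbols n lam H) ≤ Subalgebra.centralizer ℂ {U} := by
    refine Subalgebra.topologicalClosure_minimal (Algebra.adjoin_le ?_)
      (Set.isClosed_centralizer {U})
    rintro _ ⟨a, ha, rfl⟩
    rw [SetLike.mem_coe, Subalgebra.mem_centralizer_iff]
    rintro _ rfl
    ext1 f
    exact (toeplitz_rotOp ha hg f).symm
  exact (DFunLike.congr_fun ((Subalgebra.mem_centralizer_iff ℂ).1 (hle hT) U rfl) f).symm

theorem isCommutativeSubalgebra_toeplitzAlgebra (hn : 3 ≤ n) :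
    IsCommutativeSubalgebra (toeplitzAlgebra n lam (invariantSymbols n lam (subgroupSOn n))) :=
  fun _ hS _ hT => mul_comm_of_commute_rotOp hn
    (fun g => apply_rotOp_of_mem_toeplitzAlgebra hS (Subgroup.mem_top g))
    fun g => apply_rotOp_of_mem_toeplitzAlgebra hT (Subgroup.mem_top g)

end Commutativity

/-! ### Commuting operators in finite dimension -/

theorem exists_invtSubmodule_of_commute {𝕜 E : Type*} [Field 𝕜] [IsAlgClosed 𝕜] [AddCommGroup E]
    [Module 𝕜 E] [FiniteDimensional 𝕜 E] (hE : 1 < Module.finrank 𝕜 E) {F : Set (Module.End 𝕜 E)}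
    (hF : ∀ S ∈ F, ∀ T ∈ F, Commute S T) :
    ∃ W : Submodule 𝕜 E, W ≠ ⊥ ∧ W ≠ ⊤ ∧ ∀ T ∈ F, W ∈ T.invtSubmodule := by
  have : Nontrivial E := Module.nontrivial_of_finrank_pos (R := 𝕜) (by omega)
  by_cases hproper : ∃ T ∈ F, ∃ μ, T.eigenspace μ ≠ ⊥ ∧ T.eigenspace μ ≠ ⊤
  · obtain ⟨T, hT, μ, hbot, htop⟩ := hproper
    exact ⟨_, hbot, htop, fun S hS =>
      Module.End.mapsTo_genEigenspace_of_comm (hF T hT S hS) μ 1⟩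
  · push Not at hproper
    have hscalar : ∀ T ∈ F, ∃ μ : 𝕜, ∀ x, T x = μ • x := fun T hT => by
      obtain ⟨μ, hμ⟩ := Module.End.exists_eigenvalue T
      exact ⟨μ, fun x => Module.End.mem_eigenspace_iff.1 (hproper T hT μ hμ ▸ Submodule.mem_top)⟩
    obtain ⟨v, hv⟩ := exists_ne (0 : E)
    refine ⟨𝕜 ∙ v, by simpa using hv, fun htop => ?_, fun T hT x hx => ?_⟩
    · rw [← finrank_top, ← htop, finrank_span_singleton hv] at hE
      exact hE.false
    · obtain ⟨μ, hμ⟩ := hscalar T hT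
      rw [Submodule.mem_comap, hμ]
      exact Submodule.smul_mem _ μ hx

theorem exists_inner_apply_eq_zero_of_commute {𝕜 E : Type*} [RCLike 𝕜] [IsAlgClosed 𝕜]
    [NormedAddCommGroup E] [InnerProductSpace 𝕜 E] [FiniteDimensional 𝕜 E]
    (hE : 1 < Module.finrank 𝕜 E) {F : Set (Module.End 𝕜 E)}
    (hF : ∀ S ∈ F, ∀ T ∈ F, Commute S T) :
    ∃ x y : E, x ≠ 0 ∧ y ≠ 0 ∧ ∀ T ∈ F, ⟪y, T x⟫_𝕜 = 0 := by
  obtain ⟨W, hbot, htop, hinv⟩ := exists_invtSubmodule_of_commute hE hF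
  obtain ⟨x, hxW, hx⟩ := W.ne_bot_iff.1 hbot
  obtain ⟨y, hyW, hy⟩ := Wᗮ.ne_bot_iff.1 (W.orthogonal_eq_bot_iff.not.2 htop)
  exact ⟨x, y, hx, hy, fun T hT => W.inner_left_of_mem_orthogonal (hinv T hT hxW) hyW⟩

theorem finiteDimensional_of_norm_le_of_isCompact {𝕜 E : Type*} [RCLike 𝕜] [NormedAddCommGroup E]
    [InnerProductSpace 𝕜 E] {C : Set E} (hC : IsCompact C) {V : Submodule 𝕜 E} {M : ℝ}
    (hV : ∀ f ∈ V, ∀ B, (∀ k ∈ C, ‖⟪k, f⟫_𝕜‖ ≤ B) → ‖f‖ ≤ M * B) : FiniteDimensional 𝕜 V := by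
  obtain ⟨t, -, ht, hcover⟩ := hC.finite_cover_balls (e := (|M| + 1)⁻¹) (by positivity)
  have := ht.fintype
  let ev : V →ₗ[𝕜] (t → 𝕜) := LinearMap.pi fun k => (innerₛₗ 𝕜 (k : E)).comp V.subtype
  refine FiniteDimensional.of_injective ev ((injective_iff_map_eq_zero ev).2 fun f hf => ?_)
  have hnet : ∀ k ∈ C, ‖⟪k, (f : E)⟫_𝕜‖ ≤ (|M| + 1)⁻¹ * ‖f‖ := fun k hk => by
    obtain ⟨l, hl, hkl⟩ := Set.mem_iUnion₂.1 (hcover hk)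
    have hlf : ⟪l, (f : E)⟫_𝕜 = 0 := congrFun hf ⟨l, hl⟩
    calc ‖⟪k, (f : E)⟫_𝕜‖ = ‖⟪k - l, (f : E)⟫_𝕜‖ := by rw [inner_sub_left, hlf, sub_zero]
      _ ≤ ‖k - l‖ * ‖f‖ := norm_inner_le_norm _ _
      _ ≤ (|M| + 1)⁻¹ * ‖f‖ := by gcongr; exact (mem_ball_iff_norm.1 hkl).le
  have hle : ‖f‖ ≤ M / (|M| + 1) * ‖f‖ := by
    rw [div_eq_mul_inv, mul_assoc]
    exact hV f f.2 _ hnet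
  have hlt : M / (|M| + 1) < 1 := (div_lt_one (by positivity)).2 (by linarith [le_abs_self M])
  by_contra hne
  nlinarith [norm_pos_iff.2 hne]

/-! ### Semi-invariants of degree two -/

section QuadraticForms

variable {n : ℕ} {lam : ℝ} {z : Fin n → ℂ}

section QuadSpace

variable [NeZero (vMeasure n lam)] {H : Subgroup (K n)} {f : BergmanSpace n lam}

/-- The elements `f` of the Bergman space on which `H` acts by the character `(A, t) ↦ t⁻²`,
that is, `f (t A z) = t² f z` for `(A, t) ∈ H`. If `H` contains `SO(2)`, these are homogeneous
polynomials of degree two. -/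
def quadSpace (lam : ℝ) [NeZero (vMeasure n lam)] (H : Subgroup (K n)) :
    Submodule ℂ (BergmanSpace n lam) where
  carrier := {f | ∀ g ∈ H, rotOp lam g f = ((g.2⁻¹ : Circle) : ℂ) ^ 2 • f}
  zero_mem' g _ := by rw [map_zero, smul_zero]
  add_mem' hf hh g hg := by rw [map_add, hf g hg, hh g hg, smul_add]
  smul_mem' c f hf g hg := by rw [map_smul, hf g hg, smul_comm]

theorem apply_act_of_mem_quadSpace (hf : f ∈ quadSpace lam H) {g : K n} (hg : g ∈ H)
    (z : Fin n → ℂ) : f (act g z) = (g.2 : ℂ) ^ 2 * f z := by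
  simpa [rotOp_apply] using DFunLike.congr_fun (hf g⁻¹ (H.inv_mem hg)) z

theorem apply_smul_of_mem_quadSpace (hH : subgroupCircle n ≤ H) (hf : f ∈ quadSpace lam H)
    (hz : z ∈ domain n) {c : ℂ} (hc : ‖c‖ ≤ 1) : f (c • z) = c ^ 2 * f z := by
  have hclosure := closure_ball (0 : ℂ) one_ne_zero
  have hleft : DiffContOnCl ℂ (fun c : ℂ => f (c • z)) (ball 0 1) := by
    refine DifferentiableOn.diffContOnCl ?_
    rw [hclosure]
    exact (differentiableOn_coe f).comp (by fun_prop) fun c hc =>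
      smul_mem_domain hz (mem_closedBall_zero_iff.1 hc)
  have hright : DiffContOnCl ℂ (fun c : ℂ => c ^ 2 * f z) (ball 0 1) :=
    Differentiable.diffContOnCl (by fun_prop)
  refine Complex.eqOn_closure_of_eqOn_frontier isBounded_ball hleft hright ?_
    (hclosure ▸ mem_closedBall_zero_iff.2 hc)
  rw [frontier_ball (0 : ℂ) one_ne_zero]
  intro c hc
  simpa [act] using apply_act_of_mem_quadSpace hf
    (hH (show ((1, ⟨c, hc⟩) : K n) ∈ subgroupCircle n from ⟨rfl, trivial⟩)) z

theorem norm_apply_le_of_mem_quadSpace (hH : subgroupCircle n ≤ H) (hf : f ∈ quadSpace lam H)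
    {r B : ℝ} (hr : 0 < r) (hr1 : r ≤ 1)
    (hB : ∀ z ∈ closedBall (0 : Fin n → ℂ) r, ‖f z‖ ≤ B) (hz : z ∈ domain n) :
    ‖f z‖ ≤ (r ^ 2)⁻¹ * B := by
  have hrn : ‖(r : ℂ)‖ = r := by rw [Complex.norm_real, Real.norm_of_nonneg hr.le]
  have hmem : (r : ℂ) • z ∈ closedBall (0 : Fin n → ℂ) r := by
    rw [mem_closedBall_zero_iff, norm_smul, hrn]
    exact mul_le_of_le_one_right hr.le (norm_le_one_of_mem_domain hz)
  have hle := hB _ hmem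
  rw [apply_smul_of_mem_quadSpace hH hf hz (hrn.trans_le hr1), norm_mul, norm_pow, hrn] at hle
  rwa [← div_eq_inv_mul, le_div_iff₀ (by positivity), mul_comm]

theorem exists_closedBall_subset_domain (n : ℕ) :
    ∃ r : ℝ, 0 < r ∧ r ≤ 1 ∧ closedBall (0 : Fin n → ℂ) r ⊆ domain n := by
  obtain ⟨r, hr, hsub⟩ :=
    nhds_basis_closedBall.mem_iff.1 ((isOpen_domain n).mem_nhds (zero_mem_domain n))
  exact ⟨min r 1, lt_min hr one_pos, min_le_right _ _,
    (closedBall_subset_closedBall (min_le_left _ _)).trans hsub⟩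

theorem exists_norm_apply_le_of_mem_quadSpace (hH : subgroupCircle n ≤ H)
    (hf : f ∈ quadSpace lam H) : ∃ M, ∀ z ∈ domain n, ‖f z‖ ≤ M := by
  obtain ⟨r, hr, hr1, hsub⟩ := exists_closedBall_subset_domain n
  obtain ⟨B, hB⟩ := (isCompact_closedBall (0 : Fin n → ℂ) r).exists_bound_of_continuousOn
    ((differentiableOn_coe f).continuousOn.mono hsub)
  exact ⟨_, fun z => norm_apply_le_of_mem_quadSpace hH hf hr hr1 hB⟩

end QuadSpace

section FiniteDimensional

variable [IsProbabilityMeasure (vMeasure n lam)]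

theorem norm_le_of_forall_norm_apply_le {f : BergmanSpace n lam} {M : ℝ}
    (hM : ∀ z ∈ domain n, ‖f z‖ ≤ M) : ‖f‖ ≤ M := by
  have hM0 : 0 ≤ M := (norm_nonneg _).trans (hM 0 (zero_mem_domain n))
  rw [← (bergmanIncl n lam).norm_map]
  have hle := Lp.norm_le_of_ae_bound (f := bergmanIncl n lam f) hM0 (by
    filter_upwards [incl_ae_eq_coe f, ae_mem_domain n lam] with z hfz hz
    rw [hfz]
    exact hM z hz)
  simpa [measureUnivNNReal] using hle

theorem finiteDimensional_quadSpace {H : Subgroup (K n)} (hH : subgroupCircle n ≤ H) :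
    FiniteDimensional ℂ (quadSpace lam H) := by
  obtain ⟨r, hr, hr1, hsub⟩ := exists_closedBall_subset_domain n
  have hC : IsCompact (kernel n lam '' closedBall 0 r) :=
    (isCompact_closedBall 0 r).image_of_continuousOn (continuousOn_kernel.mono hsub)
  refine finiteDimensional_of_norm_le_of_isCompact hC (M := (r ^ 2)⁻¹) fun f hf B hB => ?_
  refine norm_le_of_forall_norm_apply_le fun z =>
    norm_apply_le_of_mem_quadSpace hH hf hr hr1 fun w hw => ?_
  rw [← inner_kernel_left]
  exact hB _ (Set.mem_image_of_mem _ hw)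

end FiniteDimensional

/-! ### Partial sums of squares -/

/-- The quadratic form `∑ i ∈ I, z i ^ 2`, the source of semi-invariants of degree two. -/
def sumSq (I : Finset (Fin n)) (z : Fin n → ℂ) : ℂ := ∑ i ∈ I, z i ^ 2

theorem differentiable_sumSq (I : Finset (Fin n)) : Differentiable ℂ (sumSq I) := by
  unfold sumSq
  fun_prop

theorem norm_sumSq_le_one (I : Finset (Fin n)) (hz : z ∈ domain n) : ‖sumSq I z‖ ≤ 1 :=
  calc ‖sumSq I z‖ ≤ ∑ i ∈ I, ‖z i‖ ^ 2 := norm_sum_le_of_le I fun i _ => (norm_pow (z i) 2).le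
    _ ≤ ∑ i, ‖z i‖ ^ 2 :=
      Finset.sum_le_sum_of_subset_of_nonneg (Finset.subset_univ I) fun _ _ _ => by positivity
    _ ≤ 1 := hz.1.le

theorem sumSq_act {g : K n} {I : Finset (Fin n)}
    (hI : ∀ z : Fin n → ℂ, sumSq I (g.1.1.map ((↑) : ℝ → ℂ) *ᵥ z) = sumSq I z)
    (z : Fin n → ℂ) : sumSq I (act g z) = (g.2 : ℂ) ^ 2 * sumSq I z := by
  rw [← hI z, sumSq, sumSq, Finset.mul_sum]
  simp only [act, Pi.smul_apply, smul_eq_mul, mul_pow]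

theorem sumSq_univ_act (g : K n) (z : Fin n → ℂ) :
    sumSq Finset.univ (act g z) = (g.2 : ℂ) ^ 2 * sumSq Finset.univ z := by
  simpa only [sumSq, dotProduct, ← sq] using dotProduct_act g z

theorem sumSq_single (I : Finset (Fin n)) (j : Fin n) (c : ℂ) :
    sumSq I (Pi.single j c) = if j ∈ I then c ^ 2 else 0 := by
  simp [sumSq, Pi.single_apply, ite_pow]

theorem single_mem_domain (j : Fin n) : (Pi.single j (1 / 2) : Fin n → ℂ) ∈ domain n := by
  have hsum : ∑ i, ‖(Pi.single j (1 / 2) : Fin n → ℂ) i‖ ^ 2 = 1 / 4 := by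
    rw [Finset.sum_eq_single j (fun i _ hij => by simp [Pi.single_eq_of_ne hij]) (by simp)]
    norm_num
  refine ⟨by rw [hsum]; norm_num, ?_⟩
  rw [hsum]
  exact lt_add_of_lt_of_nonneg (by norm_num) (sq_nonneg _)

variable {H : Subgroup (K n)} {I : Finset (Fin n)}

theorem exists_mem_quadSpace_eqOn_sumSq [NeZero (vMeasure n lam)]
    [IsFiniteMeasure (vMeasure n lam)]
    (hI : ∀ g ∈ H, ∀ z, sumSq I (act g z) = (g.2 : ℂ) ^ 2 * sumSq I z) :
    ∃ f ∈ quadSpace lam H, Set.EqOn f (sumSq I) (domain n) := by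
  have hL : MemLp (sumSq I) 2 (vMeasure n lam) :=
    MemLp.of_bound (differentiable_sumSq I).continuous.aestronglyMeasurable 1
      ((ae_mem_domain n lam).mono fun z => norm_sumSq_le_one I)
  have hf : Set.EqOn (mkBergman _ (differentiable_sumSq I).differentiableOn hL) (sumSq I)
      (domain n) := fun z => mkBergman_apply _ hL
  refine ⟨_, fun g hg => RKHS.ext fun z => ?_, hf⟩
  rw [rotOp_apply, RKHS.coe_smul, Pi.smul_apply, smul_eq_mul]
  by_cases hz : z ∈ domain n
  · rw [hf ((act_mem_domain_iff _).2 hz), hf hz, hI _ (H.inv_mem hg)]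
    rfl
  · rw [apply_of_notMem _ hz, apply_of_notMem _ ((act_mem_domain_iff _).not.2 hz), mul_zero]

theorem one_lt_finrank_quadSpace [IsProbabilityMeasure (vMeasure n lam)]
    (hH : subgroupCircle n ≤ H) {i j : Fin n} (hi : i ∈ I) (hj : j ∉ I)
    (hI : ∀ g ∈ H, ∀ z, sumSq I (act g z) = (g.2 : ℂ) ^ 2 * sumSq I z) :
    1 < Module.finrank ℂ (quadSpace lam H) := by
  have := finiteDimensional_quadSpace (lam := lam) hH
  obtain ⟨p, hpV, hp⟩ :=
    exists_mem_quadSpace_eqOn_sumSq (lam := lam) (H := H) fun g _ => sumSq_univ_act g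
  obtain ⟨q, hqV, hq⟩ := exists_mem_quadSpace_eqOn_sumSq (lam := lam) hI
  have hli : LinearIndependent ℂ ![(⟨p, hpV⟩ : quadSpace lam H), ⟨q, hqV⟩] := by
    refine LinearIndependent.pair_iff.2 fun a b hab => ?_
    have hval : ∀ l, a * (1 / 2) ^ 2 + b * (if l ∈ I then (1 / 2) ^ 2 else 0) = 0 := fun l => by
      have hl := single_mem_domain l
      have hp_l : p (Pi.single l (1 / 2)) = (1 / 2) ^ 2 := by
        rw [hp hl, sumSq_single, if_pos (Finset.mem_univ l)]
      have hab_l := DFunLike.congr_fun (congrArg Subtype.val hab) (Pi.single l (1 / 2))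
      simpa only [Submodule.coe_add, Submodule.coe_smul, Submodule.coe_zero, RKHS.coe_add,
        RKHS.coe_smul, RKHS.coe_zero, Pi.add_apply, Pi.smul_apply, Pi.zero_apply, smul_eq_mul,
        hp_l, hq hl, sumSq_single] using hab_l
    have ha : a = 0 := by simpa [hj] using hval j
    exact ⟨ha, by simpa [hi, ha] using hval i⟩
  exact (Fintype.card_fin 2).symm.trans_le hli.fintype_card_le_finrank

end QuadraticForms

/-! ### Matrix actions of the subgroups -/

section Noncommutativity

variable {n : ℕ} {lam : ℝ} {z : Fin n → ℂ}

theorem reindex_map_mulVec {ι κ : Type*} [Fintype ι] [Fintype κ] (e : ι ≃ κ) (A : Matrix ι ι ℝ)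
    (z : κ → ℂ) (i : ι) :
    ((Matrix.reindex e e A).map ((↑) : ℝ → ℂ) *ᵥ z) (e i) = ∑ j, (A i j : ℂ) * z (e j) := by
  simp only [mulVec, dotProduct, ← e.sum_comp]
  simp

theorem cornerMatrix_mulVec_last {m : ℕ} (B : Matrix (Fin m) (Fin m) ℝ) (z : Fin (m + 1) → ℂ) :
    ((cornerMatrix B).map ((↑) : ℝ → ℂ) *ᵥ z) (Fin.last m) = z (Fin.last m) := by
  have hlast : Fin.last m = finSumFinEquiv (Sum.inr 0) := rfl
  rw [cornerMatrix, hlast, reindex_map_mulVec]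
  simp

theorem torusMatrix_mulVec_torusIndex (θ : Fin (n / 2) → ℝ) (z : Fin n → ℂ) (a : Fin 2)
    (j : Fin (n / 2)) :
    ((torusMatrix n θ).map ((↑) : ℝ → ℂ) *ᵥ z) (torusIndex n (Sum.inl (a, j))) =
      ∑ b, (rot (θ j) a b : ℂ) * z (torusIndex n (Sum.inl (b, j))) := by
  rw [torusMatrix, reindex_map_mulVec, Fintype.sum_sum_type, Fintype.sum_prod_type]
  simp [blockDiagonal_apply, apply_ite, ite_mul]

theorem sum_rot_mul_sq (θ : ℝ) (x : Fin 2 → ℂ) :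
    ∑ a, (∑ b, (rot θ a b : ℂ) * x b) ^ 2 = ∑ a, x a ^ 2 := by
  have hsc : (Real.sin θ : ℂ) ^ 2 + (Real.cos θ : ℂ) ^ 2 = 1 := by
    exact_mod_cast Real.sin_sq_add_cos_sq θ
  simp only [Fin.sum_univ_two, rot, of_apply, cons_val_zero, cons_val_one, cons_val',
    cons_val_fin_one, Complex.ofReal_neg]
  linear_combination (x 0 ^ 2 + x 1 ^ 2) * hsc

/-! ### Toeplitz operators that do not commute -/

theorem toeplitz_mem_toeplitzAlgebra {S : Set (Lp ℂ ∞ (vMeasure n lam))}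
    {a : Lp ℂ ∞ (vMeasure n lam)} (ha : a ∈ S) : toeplitz n lam a ∈ toeplitzAlgebra n lam S :=
  Subalgebra.le_topologicalClosure _ (Algebra.subset_adjoin (Set.mem_image_of_mem _ ha))

section NotCommutative

variable [NeZero (vMeasure n lam)] {H : Subgroup (K n)} {f h : BergmanSpace n lam}

theorem memLp_star_mul_of_mem_quadSpace [IsFiniteMeasure (vMeasure n lam)]
    (hH : subgroupCircle n ≤ H) (hf : f ∈ quadSpace lam H) (hh : h ∈ quadSpace lam H)
    (p : ℝ≥0∞) :
    MemLp (fun z => star (f z) * h z) p (vMeasure n lam) := by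
  obtain ⟨M, hM⟩ := exists_norm_apply_le_of_mem_quadSpace hH hf
  obtain ⟨N, hN⟩ := exists_norm_apply_le_of_mem_quadSpace hH hh
  refine MemLp.of_bound ((memLp_coe f).star.1.mul (memLp_coe h).1) (M * N) ?_
  filter_upwards [ae_mem_domain n lam] with z hz
  rw [norm_mul, norm_star]
  exact mul_le_mul (hM z hz) (hN z hz) (norm_nonneg _) ((norm_nonneg _).trans (hM z hz))

theorem star_mul_apply_act_of_mem_quadSpace (hf : f ∈ quadSpace lam H) (hh : h ∈ quadSpace lam H)
    {g : K n} (hg : g ∈ H) (z : Fin n → ℂ) :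
    star (f (act g z)) * h (act g z) = star (f z) * h z := by
  have hunit : star (g.2 : ℂ) * g.2 = 1 := by
    rw [RCLike.star_def, Complex.conj_mul', Circle.norm_coe, Complex.ofReal_one, one_pow]
  rw [apply_act_of_mem_quadSpace hf hg, apply_act_of_mem_quadSpace hh hg, star_mul', star_pow,
    mul_mul_mul_comm, ← mul_pow, hunit, one_pow, one_mul]

theorem exists_invariantSymbol_ae_eq [IsFiniteMeasure (vMeasure n lam)]
    (hH : subgroupCircle n ≤ H) (hf : f ∈ quadSpace lam H) (hh : h ∈ quadSpace lam H) :
    ∃ a ∈ invariantSymbols n lam H, a =ᵐ[vMeasure n lam] fun z => star (f z) * h z := by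
  have ha := (memLp_star_mul_of_mem_quadSpace hH hf hh ∞).coeFn_toLp
  refine ⟨_, fun g hg => ?_, ha⟩
  filter_upwards [ha, (measurePreserving_act lam g⁻¹).quasiMeasurePreserving.ae ha] with z hz hgz
  rw [hz, hgz, star_mul_apply_act_of_mem_quadSpace hf hh (H.inv_mem hg)]

theorem mul_eqOn_zero_of_inner_toeplitz_eq_zero {a : Lp ℂ ∞ (vMeasure n lam)}
    (hL : MemLp (fun z => star (f z) * h z) 2 (vMeasure n lam))
    (ha : a =ᵐ[vMeasure n lam] fun z => star (f z) * h z) (h0 : ⟪h, toeplitz n lam a f⟫_ℂ = 0) :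
    Set.EqOn (⇑f * ⇑h) 0 (domain n) := by
  have hsq : ∫ z, ‖star (f z) * h z‖ ^ 2 ∂vMeasure n lam = 0 := by
    rw [← Complex.ofReal_eq_zero, ← integral_complex_ofReal, ← h0, inner_toeplitz]
    refine integral_congr_ae ?_
    filter_upwards [ha] with z hz
    rw [hz, Complex.ofReal_pow, ← Complex.mul_conj', map_mul, RCLike.star_def, Complex.conj_conj]
    ring
  rw [integral_eq_zero_iff_of_nonneg (fun z => by positivity)
    (hL.integrable_norm_pow two_ne_zero)] at hsq
  refine eqOn_domain_of_ae_eq (lam := lam) ((differentiableOn_coe f).continuousOn.mul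
    (differentiableOn_coe h).continuousOn) continuousOn_const ?_
  filter_upwards [hsq] with z hz
  simpa using hz

theorem eq_zero_or_eq_zero_of_mul_eqOn_zero (hfh : Set.EqOn (⇑f * ⇑h) 0 (domain n)) :
    f = 0 ∨ h = 0 := by
  have hnhds := (isOpen_domain n).mem_nhds (zero_mem_domain n)
  exact (eqOn_zero_or_eqOn_zero_of_mul_eqOn_zero (isOpen_domain n) (isPreconnected_domain n)
    (differentiableOn_coe f) (differentiableOn_coe h) hfh).imp
    (fun hf => eq_zero_of_eventuallyEq_zero (zero_mem_domain n) (hf.eventuallyEq_of_mem hnhds))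
    fun hh => eq_zero_of_eventuallyEq_zero (zero_mem_domain n) (hh.eventuallyEq_of_mem hnhds)

theorem apply_mem_quadSpace {T : BergmanSpace n lam →L[ℂ] BergmanSpace n lam}
    (hT : T ∈ toeplitzAlgebra n lam (invariantSymbols n lam H)) (hf : f ∈ quadSpace lam H) :
    T f ∈ quadSpace lam H := fun g hg => by
  rw [← apply_rotOp_of_mem_toeplitzAlgebra hT hg, hf g hg, map_smul]

end NotCommutative

variable [IsProbabilityMeasure (vMeasure n lam)]

/- Commuting operators on `quadSpace` would give nonzero `f`, `h` with `⟪h, T_a f⟫ = 0` for all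
invariant `a`; for `a = conj f * h` this is `∫ |f h|² = 0`. -/
theorem not_isCommutativeSubalgebra_of_one_lt_finrank {H : Subgroup (K n)}
    (hH : subgroupCircle n ≤ H) (hdim : 1 < Module.finrank ℂ (quadSpace lam H)) :
    ¬ IsCommutativeSubalgebra (toeplitzAlgebra n lam (invariantSymbols n lam H)) := by
  intro hcomm
  have := finiteDimensional_quadSpace (lam := lam) hH
  let F : Set (Module.End ℂ (quadSpace lam H)) :=
    {A | ∃ T ∈ toeplitzAlgebra n lam (invariantSymbols n lam H),
      ∀ f, (A f : BergmanSpace n lam) = T f}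
  have hF : ∀ A ∈ F, ∀ B ∈ F, Commute A B := by
    rintro A ⟨S, hS, hA⟩ B ⟨T, hT, hB⟩
    refine LinearMap.ext fun f => Subtype.ext ?_
    rw [Module.End.mul_apply, Module.End.mul_apply, hA, hB, hB, hA]
    exact DFunLike.congr_fun (hcomm S hS T hT) (f : BergmanSpace n lam)
  obtain ⟨f, h, hf0, hh0, horth⟩ := exists_inner_apply_eq_zero_of_commute hdim hF
  obtain ⟨a, ha, hafh⟩ := exists_invariantSymbol_ae_eq hH f.2 h.2
  have hT := toeplitz_mem_toeplitzAlgebra ha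
  have h0 : ⟪(h : BergmanSpace n lam), toeplitz n lam a f⟫_ℂ = 0 :=
    horth ((toeplitz n lam a).toLinearMap.restrict fun f => apply_mem_quadSpace hT)
      ⟨_, hT, fun _ => rfl⟩
  have hfh := mul_eqOn_zero_of_inner_toeplitz_eq_zero
    (memLp_star_mul_of_mem_quadSpace hH f.2 h.2 2) hafh h0
  rcases eq_zero_or_eq_zero_of_mul_eqOn_zero hfh with hf | hh
  · exact hf0 (Subtype.ext hf)
  · exact hh0 (Subtype.ext hh)

theorem not_isCommutativeSubalgebra_of_sumSq {H : Subgroup (K n)} (hH : subgroupCircle n ≤ H)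
    {I : Finset (Fin n)} {i j : Fin n} (hi : i ∈ I) (hj : j ∉ I)
    (hI : ∀ g ∈ H, ∀ z : Fin n → ℂ, sumSq I (g.1.1.map ((↑) : ℝ → ℂ) *ᵥ z) = sumSq I z) :
    ¬ IsCommutativeSubalgebra (toeplitzAlgebra n lam (invariantSymbols n lam H)) :=
  not_isCommutativeSubalgebra_of_one_lt_finrank hH <|
    one_lt_finrank_quadSpace hH hi hj fun g hg => sumSq_act (hI g hg)

theorem not_isCommutativeSubalgebra_corner (hn : 2 ≤ n) :
    ¬ IsCommutativeSubalgebra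
      (toeplitzAlgebra n lam (invariantSymbols n lam (subgroupCorner n))) := by
  obtain ⟨m, rfl⟩ := Nat.exists_eq_add_of_le' (show 1 ≤ n by omega)
  have : Nontrivial (Fin (m + 1)) := Fin.nontrivial_iff_two_le.2 hn
  obtain ⟨j, hj⟩ := exists_ne (Fin.last m)
  refine not_isCommutativeSubalgebra_of_sumSq (Subgroup.prod_mono bot_le le_rfl)
    (Finset.mem_singleton_self (Fin.last m)) (Finset.notMem_singleton.2 hj) ?_
  rintro ⟨_, t⟩ ⟨⟨B, rfl⟩, -⟩ z
  rw [sumSq, sumSq, Finset.sum_singleton, Finset.sum_singleton]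
  exact congrArg (· ^ 2) (cornerMatrix_mulVec_last B.1 z)

theorem not_isCommutativeSubalgebra_torus (hn : 3 ≤ n) :
    ¬ IsCommutativeSubalgebra
      (toeplitzAlgebra n lam (invariantSymbols n lam (subgroupTorus n))) := by
  let p : Fin 2 ↪ Fin n :=
    ⟨fun a => torusIndex n (Sum.inl (a, ⟨0, by omega⟩)), fun a b => by simp⟩
  obtain ⟨j, -, hj⟩ : ∃ j ∈ Finset.univ, j ∉ Finset.univ.map p :=
    Finset.exists_mem_notMem_of_card_lt_card (by simp; omega)
  refine not_isCommutativeSubalgebra_of_sumSq (Subgroup.prod_mono bot_le le_rfl)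
    (Finset.mem_map_of_mem p (Finset.mem_univ 0)) hj ?_
  rintro ⟨_, t⟩ ⟨⟨θ, rfl⟩, -⟩ z
  rw [sumSq, sumSq, Finset.sum_map, Finset.sum_map,
    ← sum_rot_mul_sq (θ.toAdd ⟨0, by omega⟩) fun a => z (p a)]
  exact Finset.sum_congr rfl fun a _ =>
    congrArg (· ^ 2) (torusMatrix_mulVec_torusIndex θ.toAdd z a _)

theorem not_isCommutativeSubalgebra_circle (hn : 2 ≤ n) :
    ¬ IsCommutativeSubalgebra
      (toeplitzAlgebra n lam (invariantSymbols n lam (subgroupCircle n))) := by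
  have : Nontrivial (Fin n) := Fin.nontrivial_iff_two_le.2 hn
  obtain ⟨i, j, hij⟩ := exists_pair_ne (Fin n)
  refine not_isCommutativeSubalgebra_of_sumSq le_rfl (Finset.mem_singleton_self i)
    (Finset.notMem_singleton.2 hij.symm) ?_
  rintro ⟨_, t⟩ ⟨rfl, -⟩ z
  have hone : ((1 : SO n).1.map ((↑) : ℝ → ℂ)) = 1 :=
    Matrix.map_one _ Complex.ofReal_zero Complex.ofReal_one
  exact congrArg (sumSq {i}) (by rw [hone, one_mulVec])

end Noncommutativity

end CartanIV

end

theorem theorem3p10 (n : ℕ) (hn : 3 ≤ n) (lam : ℝ) (hlam : (n : ℝ) - 1 < lam) :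
    (CartanIV.IsCStarSubalgebra (CartanIV.toeplitzAlgebra n lam
        (CartanIV.invariantSymbols n lam (CartanIV.subgroupSOn n))) ∧
      CartanIV.IsCommutativeSubalgebra (CartanIV.toeplitzAlgebra n lam
        (CartanIV.invariantSymbols n lam (CartanIV.subgroupSOn n)))) ∧
    ∀ H : Subgroup (CartanIV.K n),
      H = CartanIV.subgroupCorner n ∨ H = CartanIV.subgroupTorus n ∨
        H = CartanIV.subgroupCircle n →
      CartanIV.IsCStarSubalgebra (CartanIV.toeplitzAlgebra n lam
          (CartanIV.invariantSymbols n lam H)) ∧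
        ¬ CartanIV.IsCommutativeSubalgebra (CartanIV.toeplitzAlgebra n lam
          (CartanIV.invariantSymbols n lam H)) := by
  have := CartanIV.isProbabilityMeasure_vMeasure (show 2 ≤ n by omega) hlam
  refine ⟨⟨CartanIV.isCStarSubalgebra_toeplitzAlgebra _,
    CartanIV.isCommutativeSubalgebra_toeplitzAlgebra hn⟩, fun H hH =>
      ⟨CartanIV.isCStarSubalgebra_toeplitzAlgebra H, ?_⟩⟩
  rcases hH with rfl | rfl | rfl
  · exact CartanIV.not_isCommutativeSubalgebra_corner (by omega)
  · exact CartanIV.not_isCommutativeSubalgebra_torus hn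
  · exact CartanIV.not_isCommutativeSubalgebra_circle (by omega)
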